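/- Let $(X,\|\cdot\|)$ be a real Banach space of Rademacher cotype $q\in[2,\infty)$, and let $C_q(X)$ be its cotype $q$ constant, i.e. the least $C\ge 0$ such that $\sum_{j=1}^m\|v_j\|^q\le C^q\,\mathbb E\|\sum_{j=1}^m\varepsilon_jv_j\|^q$ for all $m$ and all $v_1,\dots,v_m\in X$, where $\varepsilon_1,\dots,\varepsilon_m$ are independent uniform $\pm1$ signs. For $f:\{-1,1\}^n\to X$ put $\|f\|_r=(\mathbb E\|f(x)\|^r)^{1/r}$ with $x$ uniform on $\{-1,1\}^n$, $D_jf(x)=\frac12\big(f(x)-f(x_1,\dots,-x_j,\dots,x_n)\big)$ and $\|Df\|_p^p=\mathbb E\big\|\sum_{j=1}^n x'_jD_jf(x)\big\|^p$, where $x'$ is an independent copy of $x$. (a) There is a universal constant $c>0$ such that for every such $X$ and $q$, every $n$, every $f:\{-1,1\}^n\to X$ with $\|f\|_\infty\le1$ and $\mathbb Ef=0$, and every $p\in[1,2]$, $$\|Df\|_p\ \ge\ \frac{c}{q^{3/2}C_q(X)}\,\|f\|_2^{2/p}\Big(\log\frac{e\|f\|_2}{\|f\|_1}\Big)^{1/q},$$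 where the right-hand side is read as $0$ if $f=0$. (b) For every $\kappa>1$ there is a constant $c=c(\kappa)>0$, depending only on $\kappa$, such that the same inequality holds for every such $X$ and $q$, every $n$, every $p\in[1,2]$ and every $f:\{-1,1\}^n\to X$ with $\|f\|_\infty\le1$ and $\|f\|_2\ge\kappa\|f\|_1$, without the assumption $\mathbb Ef=0$. -/

import Mathlib

/-! Functions on the discrete cube with values in a normed space, and Rademacher cotype. -/

noncomputable section

/-- The discrete cube `{-1, 1}ⁿ`; `ℤˣ` is the set `{1, -1}`. -/
abbrev Cube (n : ℕ) : Type := Fin n → ℤˣ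

/-- Expectation with respect to the uniform probability measure on `{-1, 1}ⁿ`. -/
def cubeMean {n : ℕ} {E : Type*} [AddCommGroup E] [Module ℝ E] (g : Cube n → E) : E :=
  ((2 : ℝ) ^ n)⁻¹ • ∑ x : Cube n, g x

/-- `‖f‖_p = (𝔼 ‖f(x)‖ ^ p) ^ (1 / p)`. -/
def cubeLpNorm {n : ℕ} {X : Type*} [NormedAddCommGroup X] (p : ℝ) (f : Cube n → X) : ℝ :=
  (cubeMean fun x => ‖f x‖ ^ p) ^ (1 / p)

/-- The discrete derivative
`D_j f(x) = (f(x₁, …, x_j, …, x_n) - f(x₁, …, -x_j, …, x_n)) / 2`. -/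
def cubeDeriv {n : ℕ} {X : Type*} [AddCommGroup X] [Module ℝ X]
    (j : Fin n) (f : Cube n → X) (x : Cube n) : X :=
  (1 / 2 : ℝ) • (f x - f (Function.update x j (-x j)))

/-- The signed sum `∑ⱼ εⱼ vⱼ` for `ε` in the cube. -/
def signSum {n : ℕ} {X : Type*} [AddCommGroup X] (ε : Cube n) (v : Fin n → X) : X :=
  ∑ j, ((ε j : ℤˣ) : ℤ) • v j

/-- `‖Df‖_p = (𝔼 ‖∑ⱼ x'ⱼ D_j f(x)‖ ^ p) ^ (1 / p)`, where `x` and `x'` are independent and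
uniform on the cube. -/
def cubeGradNorm {n : ℕ} {X : Type*} [NormedAddCommGroup X] [NormedSpace ℝ X]
    (p : ℝ) (f : Cube n → X) : ℝ :=
  (cubeMean fun x : Cube n =>
    cubeMean fun x' : Cube n => ‖signSum x' fun j => cubeDeriv j f x‖ ^ p) ^ (1 / p)

/-- `C` is admissible in the cotype `q` inequality
`∑ⱼ ‖xⱼ‖ ^ q ≤ C ^ q 𝔼 ‖∑ⱼ εⱼ xⱼ‖ ^ q` for all finite families in `X`. -/
def IsCotypeBound (X : Type*) [NormedAddCommGroup X] (q C : ℝ) : Prop :=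
  0 ≤ C ∧ ∀ (m : ℕ) (v : Fin m → X),
    ∑ j, ‖v j‖ ^ q ≤ C ^ q * cubeMean fun ε : Cube m => ‖signSum ε v‖ ^ q

/-- `X` has Rademacher cotype `q` (used for `2 ≤ q < ∞`). -/
def HasCotype (X : Type*) [NormedAddCommGroup X] (q : ℝ) : Prop :=
  ∃ C : ℝ, IsCotypeBound X q C

/-- The cotype `q` constant `C_q(X)`: the best constant in the cotype inequality. -/
def cotypeConst (X : Type*) [NormedAddCommGroup X] (q : ℝ) : ℝ :=
  sInf {C : ℝ | IsCotypeBound X q C}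

end

open Finset

/-! Let `T_ρ` be the noise operator, so `T_1 f = f` and `T_0 f = 𝔼f`. The gradient is compared with
`f - T_ρ f`, which is estimated from both sides.

Upper bound. Multiplicative noise of mean `ρ` arises by resampling each coordinate independently
with probability `τ = 1 - ρ`. In this model `τ` times the `ρ`-derivative of `T_ρ f` is an average of
gradients `∑ⱼ ξⱼ Dⱼf`, with `ξⱼ` the new sign on resampled coordinates and `0` elsewhere
(`noiseOp_deriv_formula`). Such a sparsified Rademacher sum gains a factor `τ^(1/q)`: about `1/τ`
copies of it are the blocks of a random partition of the full sum, to which cotype applies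
(`IsCotypeBound.sparse`). Integrating `(1 - r)^(1/q - 1)` over `[ρ, 1]` gives `‖f - T_ρ f‖_p ≲
q^(3/2) C (1 - ρ)^(1/q) ‖Df‖_p` (`cubeLpNorm_sub_noiseOp_le`). The integral contributes `q`, and the
Kahane–Khintchine constant contributes `√q`.

Lower bound. Hypercontractivity and log-convexity of the noise energy show that noise with `1 - ρ ≲
1 / log (e‖f‖₂/‖f‖₁)` shrinks the `L²` norm by a fixed factor (`exists_noise_norm_le`). Hence `‖f -
T_ρ f‖₂ ≳ ‖f‖₂`, and boundedness of `f` turns this into an `Lᵖ` bound by `‖f‖₂^(2/p)`. Comparing the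
two bounds gives (b). In (a), if `‖f‖₂ < e‖f‖₁`, the logarithm is at most `2` and `ρ = 0` suffices.
-/

/-- Sums against product weights transform under coordinatewise maps. -/
theorem sum_prod_smul_comp {n : ℕ} {α β E : Type*} [Fintype α] [Fintype β] [DecidableEq β]
    [AddCommGroup E] [Module ℝ E] (h : α → β) (μ : Fin n → α → ℝ) (ν : Fin n → β → ℝ)
    (hν : ∀ k b, ∑ a with h a = b, μ k a = ν k b) (F : (Fin n → β) → E) :
    ∑ a : Fin n → α, (∏ k, μ k (a k)) • F (fun k => h (a k)) =
      ∑ b : Fin n → β, (∏ k, ν k (b k)) • F b := by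
  classical
  have hsplit : ∀ b : Fin n → β, (∏ k, ν k (b k)) • F b =
      ∑ a : Fin n → α with (fun k => h (a k)) = b,
        (∏ k, μ k (a k)) • F (fun k => h (a k)) := by
    intro b
    have h1 : ∏ k, ν k (b k) =
        ∑ a : Fin n → α with (fun k => h (a k)) = b, ∏ k, μ k (a k) := by
      simp_rw [← hν]
      rw [Finset.prod_univ_sum]
      refine Finset.sum_congr ?_ fun _ _ => rfl
      ext a
      simp [Fintype.mem_piFinset, funext_iff]
    rw [h1, Finset.sum_smul]
    refine Finset.sum_congr rfl fun a ha => ?_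
    rw [(Finset.mem_filter.mp ha).2]
  rw [Finset.sum_congr rfl fun b _ => hsplit b]
  exact (Finset.sum_fiberwise _ _ _).symm

/-- The total mass of a product of probability weights is one. -/
theorem sum_prod_eq_one {n : ℕ} {α : Type*} [Fintype α] (μ : Fin n → α → ℝ)
    (hμ : ∀ k, ∑ a, μ k a = 1) : ∑ a : Fin n → α, ∏ k, μ k (a k) = 1 := by
  have := Finset.prod_univ_sum (fun _ : Fin n => (univ : Finset α)) μ
  rw [Fintype.piFinset_univ] at this
  rw [← this]
  simp [hμ]

/-! ### Sums and means over the cube. -/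

theorem sum_units_int {M : Type*} [AddCommMonoid M] (f : ℤˣ → M) : ∑ e, f e = f 1 + f (-1) := by
  rw [show (univ : Finset ℤˣ) = {1, -1} from rfl]
  exact Finset.sum_pair (by decide)

theorem sum_cube_succ {n : ℕ} {M : Type*} [AddCommMonoid M] (F : Cube (n + 1) → M) :
    ∑ x, F x = ∑ x : Cube n, (F (Fin.cons 1 x) + F (Fin.cons (-1) x)) := by
  rw [← (Fin.consEquiv fun _ : Fin (n + 1) => ℤˣ).sum_comp, Fintype.sum_prod_type_right]
  exact Finset.sum_congr rfl fun x _ => sum_units_int _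

section Mean

variable {n : ℕ}

theorem cubeMean_eq_sum_prod {E : Type*} [AddCommGroup E] [Module ℝ E] (g : Cube n → E) :
    cubeMean g = ∑ x : Cube n, (∏ _k : Fin n, (1 / 2 : ℝ)) • g x := by
  simp [cubeMean, Finset.smul_sum]

theorem cubeMean_add (f g : Cube n → ℝ) :
    cubeMean (fun x => f x + g x) = cubeMean f + cubeMean g := by
  simp [cubeMean, Finset.sum_add_distrib, mul_add]

theorem cubeMean_const_mul (c : ℝ) (f : Cube n → ℝ) :
    cubeMean (fun x => c * f x) = c * cubeMean f := by
  simp only [cubeMean, ← Finset.mul_sum, smul_eq_mul]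
  ring

theorem cubeMean_const (c : ℝ) : cubeMean (fun _ : Cube n => c) = c := by
  simp [cubeMean]

theorem cubeMean_mono {f g : Cube n → ℝ} (h : ∀ x, f x ≤ g x) : cubeMean f ≤ cubeMean g := by
  unfold cubeMean
  simp only [smul_eq_mul]
  gcongr with x
  exact h x

theorem cubeMean_nonneg {f : Cube n → ℝ} (h : ∀ x, 0 ≤ f x) : 0 ≤ cubeMean f :=
  (cubeMean_const (n := n) 0).symm.le.trans (cubeMean_mono h)

theorem cubeMean_sum {ι : Type*} (s : Finset ι) (f : ι → Cube n → ℝ) :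
    cubeMean (fun x => ∑ i ∈ s, f i x) = ∑ i ∈ s, cubeMean (f i) := by
  simp only [cubeMean, smul_eq_mul]
  rw [Finset.sum_comm, Finset.mul_sum]

theorem cubeMean_mul_left {E : Type*} [AddCommGroup E] [Module ℝ E] (y : Cube n) (g : Cube n → E) :
    cubeMean (fun x => g (y * x)) = cubeMean g := by
  unfold cubeMean
  congr 1
  exact Fintype.sum_equiv (Equiv.mulLeft y) _ _ fun _ => rfl

theorem cubeMean_rpow_le {r : ℝ} (hr : 1 ≤ r) {f : Cube n → ℝ} (hf : ∀ x, 0 ≤ f x) :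
    cubeMean f ^ r ≤ cubeMean (fun x => f x ^ r) := by
  have h := Real.rpow_arith_mean_le_arith_mean_rpow univ (fun _ : Cube n => ((2 : ℝ) ^ n)⁻¹) f
    (fun _ _ => by positivity) (by simp) (fun x _ => hf x) hr
  simpa [cubeMean, Finset.mul_sum] using h

theorem cubeMean_mul_sq_le (f g : Cube n → ℝ) :
    cubeMean (fun x => f x * g x) ^ 2 ≤
      cubeMean (fun x => f x ^ 2) * cubeMean (fun x => g x ^ 2) := by
  have h := Finset.sum_mul_sq_le_sq_mul_sq univ f g
  simp only [cubeMean, smul_eq_mul]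
  calc _ = (((2 : ℝ) ^ n)⁻¹ * ((2 : ℝ) ^ n)⁻¹) * (∑ x, f x * g x) ^ 2 := by ring
    _ ≤ (((2 : ℝ) ^ n)⁻¹ * ((2 : ℝ) ^ n)⁻¹) * ((∑ x, f x ^ 2) * ∑ x, g x ^ 2) := by gcongr
    _ = _ := by ring

theorem cubeMean_succ {E : Type*} [AddCommGroup E] [Module ℝ E] (g : Cube (n + 1) → E) :
    cubeMean g = cubeMean fun x : Cube n =>
      (1 / 2 : ℝ) • (g (Fin.cons 1 x) + g (Fin.cons (-1) x)) := by
  unfold cubeMean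
  rw [sum_cube_succ, ← Finset.smul_sum, smul_smul, pow_succ, mul_inv]
  norm_num

end Mean

/-! ### The noise operator. -/

section Noise

variable {n : ℕ}

/-- The density of a vector of independent signs with mean `ρ`. -/
noncomputable def noiseWeight (ρ : ℝ) (y : Cube n) : ℝ :=
  ∏ j, (1 + ρ * (((y j : ℤˣ) : ℤ) : ℝ)) / 2

/-- The noise operator on the cube. -/
noncomputable def noiseOp {E : Type*} [AddCommGroup E] [Module ℝ E] (ρ : ℝ) (f : Cube n → E)
    (x : Cube n) : E :=
  ∑ y, noiseWeight ρ y • f (y * x)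

theorem units_int_cast_cases (e : ℤˣ) : (((e : ℤˣ) : ℤ) : ℝ) = 1 ∨ (((e : ℤˣ) : ℤ) : ℝ) = -1 := by
  rcases Int.units_eq_one_or e with rfl | rfl <;> simp

theorem noiseWeight_nonneg {ρ : ℝ} (h0 : 0 ≤ ρ) (h1 : ρ ≤ 1) (y : Cube n) :
    0 ≤ noiseWeight ρ y := by
  refine Finset.prod_nonneg fun j _ => ?_
  rcases units_int_cast_cases (y j) with h | h <;> rw [h] <;> linarith

theorem sum_noiseWeight (ρ : ℝ) : ∑ y : Cube n, noiseWeight ρ y = 1 := by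
  refine sum_prod_eq_one (fun _ e => (1 + ρ * (((e : ℤˣ) : ℤ) : ℝ)) / 2) fun _ => ?_
  rw [sum_units_int]
  push_cast
  ring

theorem noiseOp_one {E : Type*} [AddCommGroup E] [Module ℝ E] (f : Cube n → E) (x : Cube n) :
    noiseOp 1 f x = f x := by
  unfold noiseOp
  rw [Finset.sum_eq_single 1]
  · simp [noiseWeight]
  · intro y _ hy
    obtain ⟨j, hj⟩ : ∃ j, y j ≠ 1 := by
      by_contra! h
      exact hy (funext h)
    have : noiseWeight 1 y = 0 := by
      refine Finset.prod_eq_zero (Finset.mem_univ j) ?_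
      rcases Int.units_eq_one_or (y j) with h | h
      · exact absurd h hj
      · simp [h]
    rw [this, zero_smul]
  · simp

theorem noiseOp_zero {E : Type*} [AddCommGroup E] [Module ℝ E] (f : Cube n → E) (x : Cube n) :
    noiseOp 0 f x = cubeMean f := by
  have : ∀ y : Cube n, noiseWeight 0 y = ((2 : ℝ) ^ n)⁻¹ := by intro y; simp [noiseWeight]
  simp only [noiseOp, this, ← Finset.smul_sum, cubeMean]
  congr 1
  exact Fintype.sum_equiv (Equiv.mulRight x) _ _ fun _ => rfl

theorem norm_noiseOp_le {X : Type*} [NormedAddCommGroup X] [NormedSpace ℝ X] {ρ : ℝ}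
    (h0 : 0 ≤ ρ) (h1 : ρ ≤ 1) (f : Cube n → X) (x : Cube n) :
    ‖noiseOp ρ f x‖ ≤ noiseOp ρ (fun x => ‖f x‖) x := by
  refine (norm_sum_le _ _).trans (Finset.sum_le_sum fun y _ => ?_)
  rw [norm_smul, Real.norm_of_nonneg (noiseWeight_nonneg h0 h1 y), smul_eq_mul]

theorem noiseOp_mono {ρ : ℝ} (h0 : 0 ≤ ρ) (h1 : ρ ≤ 1) {f g : Cube n → ℝ} (h : ∀ x, f x ≤ g x)
    (x : Cube n) : noiseOp ρ f x ≤ noiseOp ρ g x :=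
  Finset.sum_le_sum fun y _ => mul_le_mul_of_nonneg_left (h _) (noiseWeight_nonneg h0 h1 y)

theorem noiseOp_const (ρ c : ℝ) (x : Cube n) : noiseOp ρ (fun _ => c) x = c := by
  simp [noiseOp, ← Finset.sum_mul, sum_noiseWeight]

/-- The product of independent signs of means `ρ` and `σ` is a sign of mean `ρ * σ`. -/
theorem noiseOp_noiseOp (ρ σ : ℝ) (f : Cube n → ℝ) (x : Cube n) :
    noiseOp ρ (noiseOp σ f) x = noiseOp (ρ * σ) f x := by
  have h := sum_prod_smul_comp (n := n) (α := ℤˣ × ℤˣ) (fun a => a.2 * a.1)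
    (fun _ a => (1 + ρ * (((a.1 : ℤˣ) : ℤ) : ℝ)) / 2 * ((1 + σ * (((a.2 : ℤˣ) : ℤ) : ℝ)) / 2))
    (fun _ e => (1 + ρ * σ * (((e : ℤˣ) : ℤ) : ℝ)) / 2)
    (fun _ e => by
      rw [Finset.sum_filter, Fintype.sum_prod_type]
      simp only [sum_units_int]
      rcases Int.units_eq_one_or e with rfl | rfl <;> simp <;> ring)
    (fun y => f (y * x))
  have h2 : noiseOp (ρ * σ) f x = _ := h.symm
  rw [h2, ← (Equiv.arrowProdEquivProdArrow (Fin n) (fun _ => ℤˣ) (fun _ => ℤˣ)).symm.sum_comp,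
    Fintype.sum_prod_type]
  simp only [noiseOp, Finset.smul_sum, smul_smul]
  refine Finset.sum_congr rfl fun y _ => Finset.sum_congr rfl fun z _ => ?_
  simp only [Equiv.arrowProdEquivProdArrow, Equiv.coe_fn_symm_mk, Finset.prod_mul_distrib]
  rw [← mul_assoc]
  rfl

/-- Every element of the cube is its own inverse, so the substitution `x ↦ y * x` moves the
translation from one factor to the other. -/
theorem cubeMean_mul_noiseOp (ρ : ℝ) (f g : Cube n → ℝ) :
    cubeMean (fun x => f x * noiseOp ρ g x) = cubeMean (fun x => noiseOp ρ f x * g x) := by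
  simp only [noiseOp, Finset.mul_sum, Finset.sum_mul, smul_eq_mul]
  rw [cubeMean_sum, cubeMean_sum]
  refine Finset.sum_congr rfl fun y _ => ?_
  rw [← cubeMean_mul_left y]
  refine congrArg cubeMean (funext fun x => ?_)
  have hy : y * (y * x) = x := by
    rw [← mul_assoc]
    have : y * y = 1 := funext fun j => Int.units_mul_self (y j)
    rw [this, one_mul]
  rw [hy]
  ring

theorem cubeMean_noiseOp_sq (ρ : ℝ) (g : Cube n → ℝ) :
    cubeMean (fun x => noiseOp ρ g x ^ 2) = cubeMean (fun x => g x * noiseOp (ρ ^ 2) g x) := by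
  simp only [sq]
  rw [← cubeMean_mul_noiseOp]
  simp only [noiseOp_noiseOp]

/-- Noise fixes the part of `g` even in the first coordinate and multiplies the odd part by `ρ`.
This drives the induction on dimension. -/
theorem noiseOp_cons (ρ : ℝ) (g : Cube (n + 1) → ℝ) (e : ℤˣ) (x : Cube n) :
    noiseOp ρ g (Fin.cons e x) =
      noiseOp ρ (fun x => (g (Fin.cons 1 x) + g (Fin.cons (-1) x)) / 2) x +
        ρ * (((e : ℤˣ) : ℤ) : ℝ) *
          noiseOp ρ (fun x => (g (Fin.cons 1 x) - g (Fin.cons (-1) x)) / 2) x := by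
  have hcons : ∀ (e' : ℤˣ) (y : Cube n),
      ((Fin.cons e' y : Cube (n + 1)) * Fin.cons e x : Cube (n + 1)) =
        Fin.cons (e' * e) (y * x) := by
    intro e' y
    funext j
    refine Fin.cases ?_ (fun i => ?_) j <;> simp
  have hw : ∀ (e' : ℤˣ) (y : Cube n), noiseWeight ρ (Fin.cons e' y : Cube (n + 1)) =
      (1 + ρ * (((e' : ℤˣ) : ℤ) : ℝ)) / 2 * noiseWeight ρ y := by
    intro e' y
    simp only [noiseWeight, Fin.prod_univ_succ, Fin.cons_zero, Fin.cons_succ]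
  unfold noiseOp
  rw [sum_cube_succ, Finset.mul_sum, ← Finset.sum_add_distrib]
  refine Finset.sum_congr rfl fun y _ => ?_
  simp only [hcons, hw, smul_eq_mul]
  rcases Int.units_eq_one_or e with rfl | rfl <;> simp <;> ring

end Noise

/-! ### Hypercontractivity. -/

theorem sum_range_two_mul_add_one (f : ℕ → ℝ) (k : ℕ) :
    ∑ m ∈ range (2 * k + 1), f m =
      ∑ i ∈ range (k + 1), f (2 * i) + ∑ i ∈ range k, f (2 * i + 1) := by
  induction k with
  | zero => simp
  | succ k ih =>
    rw [show 2 * (k + 1) + 1 = 2 * k + 1 + 1 + 1 by ring, sum_range_succ, sum_range_succ, ih,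
      sum_range_succ _ (k + 1), sum_range_succ _ k, sum_range_succ _ k,
      show 2 * (k + 1) = 2 * k + 1 + 1 by ring]
    ring

/-- The ratio of consecutive left-hand binomials is that of the `k.choose i` times `(2k - 2i - 1) /
(2i + 1)`, which is at most `2k - 1`. -/
theorem choose_two_mul_le (k i : ℕ) (hk : 1 ≤ k) (hi : i ≤ k) :
    ((2 * k).choose (2 * i) : ℝ) ≤ (2 * k - 1 : ℝ) ^ i * k.choose i := by
  have hk' : (1 : ℝ) ≤ k := by exact_mod_cast hk
  induction i with
  | zero => simp
  | succ i ih =>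
    have ih := ih (by omega)
    have h1 : ((2 * k).choose (2 * i + 1) : ℝ) * (2 * i + 1) =
        (2 * k).choose (2 * i) * (2 * k - 2 * i) := by
      have h := Nat.choose_succ_right_eq (2 * k) (2 * i)
      have h' := congrArg (Nat.cast (R := ℝ)) h
      push_cast [Nat.cast_sub (show 2 * i ≤ 2 * k by omega)] at h'
      exact h'
    have h2 : ((2 * k).choose (2 * i + 1 + 1) : ℝ) * (2 * i + 2) =
        (2 * k).choose (2 * i + 1) * (2 * k - 2 * i - 1) := by
      have h := Nat.choose_succ_right_eq (2 * k) (2 * i + 1)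
      have h' := congrArg (Nat.cast (R := ℝ)) h
      push_cast [Nat.cast_sub (show 2 * i + 1 ≤ 2 * k by omega)] at h'
      linear_combination h'
    have h3 : (k.choose (i + 1) : ℝ) * (i + 1) = k.choose i * (k - i) := by
      have h := Nat.choose_succ_right_eq k i
      have h' := congrArg (Nat.cast (R := ℝ)) h
      push_cast [Nat.cast_sub (show i ≤ k by omega)] at h'
      exact h'
    have hik : (i : ℝ) + 1 ≤ k := by exact_mod_cast hi
    have hi0 : (0 : ℝ) ≤ i := Nat.cast_nonneg i
    have e1 : ((2 * k).choose (2 * (i + 1)) : ℝ) =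
        (2 * k).choose (2 * i) * ((k - i) / (i + 1)) * ((2 * k - 2 * i - 1) / (2 * i + 1)) := by
      rw [show 2 * (i + 1) = 2 * i + 1 + 1 by ring]
      field_simp
      linear_combination ((2 * i + 1) * h2 + (2 * k - 2 * i - 1) * h1) / 2
    have e2 : (k.choose (i + 1) : ℝ) = k.choose i * ((k - i) / (i + 1)) := by
      field_simp
      linear_combination h3
    have hr : (2 * k - 2 * i - 1 : ℝ) / (2 * i + 1) ≤ 2 * k - 1 := by
      rw [div_le_iff₀ (by positivity)]
      nlinarith
    have hki : (0 : ℝ) ≤ (k - i) / (i + 1) := div_nonneg (by linarith) (by positivity)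
    have hr0 : (0 : ℝ) ≤ (2 * k - 2 * i - 1 : ℝ) / (2 * i + 1) :=
      div_nonneg (by linarith) (by positivity)
    have hp : (0 : ℝ) ≤ 2 * k - 1 := by linarith
    rw [e1, e2]
    calc _ ≤ ((2 * k - 1 : ℝ) ^ i * k.choose i) * ((k - i) / (i + 1)) * (2 * k - 1) := by
          gcongr
      _ = _ := by ring

/-- The two-point hypercontractive inequality from `L²` to `L²ᵏ`. -/
theorem two_point_hypercontractive {k : ℕ} (hk : 1 ≤ k) {ρ : ℝ} (hρ : ρ ^ 2 * (2 * k - 1) ≤ 1)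
    (a b : ℝ) :
    ((a + ρ * b) ^ (2 * k) + (a - ρ * b) ^ (2 * k)) / 2 ≤ (a ^ 2 + b ^ 2) ^ k := by
  have hk' : (1 : ℝ) ≤ k := by exact_mod_cast hk
  -- Averaging over the sign of `b` cancels the odd powers. What remains is compared termwise with
  -- the expansion of `(a ^ 2 + b ^ 2) ^ k`.
  have hL : ((a + ρ * b) ^ (2 * k) + (a - ρ * b) ^ (2 * k)) / 2 =
      ∑ i ∈ range (k + 1), (ρ * b) ^ (2 * i) * a ^ (2 * k - 2 * i) * (2 * k).choose (2 * i) := by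
    have h1 : a + ρ * b = ρ * b + a := by ring
    have h2 : a - ρ * b = -(ρ * b) + a := by ring
    rw [h1, h2, add_pow, add_pow, ← Finset.sum_add_distrib, sum_range_two_mul_add_one]
    have hodd : ∀ i, (ρ * b) ^ (2 * i + 1) * a ^ (2 * k - (2 * i + 1)) *
        (2 * k).choose (2 * i + 1) + (-(ρ * b)) ^ (2 * i + 1) * a ^ (2 * k - (2 * i + 1)) *
        (2 * k).choose (2 * i + 1) = 0 := by
      intro i
      rw [Odd.neg_pow ⟨i, rfl⟩]
      ring
    simp only [hodd, Finset.sum_const_zero, add_zero]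
    rw [Finset.sum_div]
    refine Finset.sum_congr rfl fun i _ => ?_
    rw [Even.neg_pow ⟨i, by ring⟩]
    ring
  rw [hL, add_comm (a ^ 2), add_pow]
  refine Finset.sum_le_sum fun i hi => ?_
  have hik : i ≤ k := by
    have := Finset.mem_range.mp hi
    omega
  have hp : (0 : ℝ) ≤ 2 * k - 1 := by linarith
  have ha : a ^ (2 * k - 2 * i) = (a ^ 2) ^ (k - i) := by
    rw [← pow_mul]
    congr 1
    omega
  have hb : (ρ * b) ^ (2 * i) = (ρ ^ 2) ^ i * (b ^ 2) ^ i := by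
    rw [pow_mul, mul_pow, mul_pow]
  rw [ha, hb]
  calc (ρ ^ 2) ^ i * (b ^ 2) ^ i * (a ^ 2) ^ (k - i) * ((2 * k).choose (2 * i) : ℝ)
      ≤ (ρ ^ 2) ^ i * (b ^ 2) ^ i * (a ^ 2) ^ (k - i) *
          ((2 * k - 1 : ℝ) ^ i * k.choose i) := by
        gcongr
        exact choose_two_mul_le k i hk hik
    _ = (ρ ^ 2 * (2 * k - 1)) ^ i * ((b ^ 2) ^ i * (a ^ 2) ^ (k - i) * k.choose i) := by
        rw [mul_pow]
        ring
    _ ≤ 1 * ((b ^ 2) ^ i * (a ^ 2) ^ (k - i) * k.choose i) := by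
        gcongr
        exact pow_le_one₀ (by positivity) hρ
    _ = _ := one_mul _

/-- Minkowski's inequality in `Lᵏ`, free of roots; it is applied to squares of noised functions. -/
theorem cubeMean_add_pow_le {n k : ℕ} (hk : 1 ≤ k) {u v : Cube n → ℝ} (hu : ∀ x, 0 ≤ u x)
    (hv : ∀ x, 0 ≤ v x) {a b : ℝ} (ha : 0 ≤ a) (hb : 0 ≤ b)
    (hua : cubeMean (fun x => u x ^ k) ≤ a ^ k) (hvb : cubeMean (fun x => v x ^ k) ≤ b ^ k) :
    cubeMean (fun x => (u x + v x) ^ k) ≤ (a + b) ^ k := by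
  have hk0 : (k : ℝ) ≠ 0 := by
    have : k ≠ 0 := by omega
    exact_mod_cast this
  have hM := Real.Lp_add_le_of_nonneg (s := (univ : Finset (Cube n))) (f := u) (g := v)
    (p := k) (by exact_mod_cast hk) (fun x _ => hu x) (fun x _ => hv x)
  simp only [Real.rpow_natCast] at hM
  have key : ∀ {w : Cube n → ℝ} {c : ℝ}, (∀ x, 0 ≤ w x) → 0 ≤ c →
      cubeMean (fun x => w x ^ k) ≤ c ^ k →
      (∑ x, w x ^ k) ^ (1 / (k : ℝ)) ≤ ((2 : ℝ) ^ n) ^ (1 / (k : ℝ)) * c := by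
    intro w c hw hc h
    have h1 : ∑ x, w x ^ k ≤ (2 : ℝ) ^ n * c ^ k := by
      have h2 : ((2 : ℝ) ^ n)⁻¹ * ∑ x, w x ^ k ≤ c ^ k := h
      rwa [inv_mul_le_iff₀ (by positivity)] at h2
    calc (∑ x, w x ^ k) ^ (1 / (k : ℝ)) ≤ ((2 : ℝ) ^ n * c ^ k) ^ (1 / (k : ℝ)) := by
          refine Real.rpow_le_rpow (Finset.sum_nonneg fun x _ => pow_nonneg (hw x) _) h1 ?_
          positivity
      _ = _ := by
          rw [Real.mul_rpow (by positivity) (by positivity), ← Real.rpow_natCast c,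
            ← Real.rpow_mul hc, mul_one_div_cancel hk0, Real.rpow_one]
  have h1 := hM.trans (add_le_add (key hu ha hua) (key hv hb hvb))
  have hS : 0 ≤ ∑ x, (u x + v x) ^ k :=
    Finset.sum_nonneg fun x _ => pow_nonneg (add_nonneg (hu x) (hv x)) _
  have h2 := pow_le_pow_left₀ (by positivity) h1 k
  have e : ∀ y : ℝ, 0 ≤ y → (y ^ (1 / (k : ℝ))) ^ k = y := by
    intro y hy
    rw [← Real.rpow_natCast, ← Real.rpow_mul hy, one_div_mul_cancel hk0, Real.rpow_one]
  rw [e _ hS, ← mul_add, mul_pow, e _ (by positivity)] at h2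
  simp only [cubeMean, smul_eq_mul]
  rwa [inv_mul_le_iff₀ (by positivity)]

/-- Hypercontractivity of the noise operator from `L²` to `L²ᵏ`. -/
theorem noiseOp_hypercontractive {k : ℕ} (hk : 1 ≤ k) {ρ : ℝ} (hρ : ρ ^ 2 * (2 * k - 1) ≤ 1) :
    ∀ {n : ℕ} (g : Cube n → ℝ),
      cubeMean (fun x => noiseOp ρ g x ^ (2 * k)) ≤ cubeMean (fun x => g x ^ 2) ^ k := by
  intro n
  induction n with
  | zero =>
    intro g
    have h : ∀ x : Cube 0, noiseOp ρ g x = g x := by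
      intro x
      rw [noiseOp, Fintype.sum_subsingleton _ x, Subsingleton.elim (x * x) x]
      simp [noiseWeight]
    simp only [h, cubeMean, Fintype.sum_subsingleton _ (1 : Cube 0)]
    simp [← pow_mul]
  | succ n ih =>
    intro g
    set a : Cube n → ℝ := fun x => (g (Fin.cons 1 x) + g (Fin.cons (-1) x)) / 2 with ha
    set b : Cube n → ℝ := fun x => (g (Fin.cons 1 x) - g (Fin.cons (-1) x)) / 2 with hb
    have hg : cubeMean (fun x => g x ^ 2) =
        cubeMean (fun x => a x ^ 2) + cubeMean (fun x => b x ^ 2) := by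
      rw [cubeMean_succ, ← cubeMean_add]
      refine congrArg cubeMean (funext fun x => ?_)
      simp only [ha, hb, smul_eq_mul]
      ring
    rw [hg, cubeMean_succ]
    -- The two-point inequality handles the first coordinate; Minkowski and the induction hypothesis
    -- handle the rest.
    calc _ ≤ cubeMean (fun x => (noiseOp ρ a x ^ 2 + noiseOp ρ b x ^ 2) ^ k) := by
          refine cubeMean_mono fun x => ?_
          simp only [noiseOp_cons, smul_eq_mul, ← ha, ← hb]
          have := two_point_hypercontractive hk hρ (noiseOp ρ a x) (noiseOp ρ b x)
          refine le_of_eq_of_le ?_ this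
          simp
          ring
      _ ≤ _ := by
          refine cubeMean_add_pow_le hk (fun _ => sq_nonneg _) (fun _ => sq_nonneg _)
            (cubeMean_nonneg fun _ => sq_nonneg _) (cubeMean_nonneg fun _ => sq_nonneg _) ?_ ?_
          · simpa only [← pow_mul] using ih a
          · simpa only [← pow_mul] using ih b

theorem sum_noiseWeight_mul_coord {n : ℕ} (ρ : ℝ) (j : Fin n) :
    ∑ y : Cube n, noiseWeight ρ y * (((y j : ℤˣ) : ℤ) : ℝ) = ρ := by
  have h := Finset.prod_univ_sum (fun _ : Fin n => (univ : Finset ℤˣ))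
    (fun k e => (1 + ρ * (((e : ℤˣ) : ℤ) : ℝ)) / 2 * if k = j then (((e : ℤˣ) : ℤ) : ℝ) else 1)
  rw [Fintype.piFinset_univ] at h
  simp only [Finset.prod_mul_distrib, Finset.prod_ite_eq', Finset.mem_univ, if_true] at h
  refine h.symm.trans ?_
  rw [Finset.prod_eq_single j]
  · simp only [sum_units_int, if_true]
    push_cast
    ring
  · intro k _ hk
    simp only [sum_units_int, if_neg hk]
    push_cast
    ring
  · simp

theorem signSum_eq {n : ℕ} {X : Type*} [AddCommGroup X] [Module ℝ X] (ε : Cube n) (v : Fin n → X) :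
    signSum ε v = ∑ j, (((ε j : ℤˣ) : ℤ) : ℝ) • v j := by
  simp only [signSum, Int.cast_smul_eq_zsmul]

/-- Each coordinate of the noise has mean `ρ`, so Rademacher sums are eigenvectors. Through this,
hypercontractivity yields moment comparison. -/
theorem noiseOp_signSum {n : ℕ} {X : Type*} [AddCommGroup X] [Module ℝ X] (ρ : ℝ) (v : Fin n → X)
    (x : Cube n) : noiseOp ρ (fun ε => signSum ε v) x = ρ • signSum x v := by
  simp only [noiseOp, signSum_eq, Finset.smul_sum, smul_smul]
  rw [Finset.sum_comm]
  refine Finset.sum_congr rfl fun j _ => ?_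
  rw [← Finset.sum_smul]
  congr 1
  conv_rhs => rw [← sum_noiseWeight_mul_coord ρ j, Finset.sum_mul]
  refine Finset.sum_congr rfl fun y _ => ?_
  simp only [Pi.mul_apply, Units.val_mul]
  push_cast
  ring

/-! ### Moments of vector-valued Rademacher sums. -/

section Kahane

variable {X : Type*} [NormedAddCommGroup X] [NormedSpace ℝ X] {n : ℕ}

/-- The eigenvector identity and the triangle inequality give `ρ‖S‖ ≤ T_ρ‖S‖` pointwise. Scalar
hypercontractivity then applies at the critical `ρ = (2k - 1)^(-1/2)`. -/
theorem cubeMean_norm_signSum_pow_le {k : ℕ} (hk : 1 ≤ k) (v : Fin n → X) :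
    cubeMean (fun ε : Cube n => ‖signSum ε v‖ ^ (2 * k)) ≤
      ((2 * k - 1 : ℝ) * cubeMean (fun ε : Cube n => ‖signSum ε v‖ ^ 2)) ^ k := by
  have hk' : (1 : ℝ) ≤ k := by exact_mod_cast hk
  have hp : (0 : ℝ) < 2 * k - 1 := by linarith
  set ρ : ℝ := (√(2 * k - 1))⁻¹ with hρ
  have hs : 0 < √(2 * k - 1 : ℝ) := Real.sqrt_pos.mpr hp
  have hρ0 : 0 ≤ ρ := by positivity
  have hρ2 : ρ ^ 2 = (2 * k - 1 : ℝ)⁻¹ := by rw [hρ, inv_pow, Real.sq_sqrt hp.le]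
  have hρ1 : ρ ≤ 1 := by
    refine inv_le_one_of_one_le₀ (Real.one_le_sqrt.mpr (by linarith))
  have hH := noiseOp_hypercontractive hk (ρ := ρ) (by rw [hρ2, inv_mul_cancel₀ hp.ne'])
    (fun ε : Cube n => ‖signSum ε v‖)
  have hle : (ρ ^ 2) ^ k * cubeMean (fun ε : Cube n => ‖signSum ε v‖ ^ (2 * k)) ≤
      cubeMean (fun ε : Cube n => ‖signSum ε v‖ ^ 2) ^ k := by
    refine le_trans ?_ hH
    rw [← cubeMean_const_mul]
    refine cubeMean_mono fun x => ?_
    rw [← pow_mul, ← mul_pow]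
    refine pow_le_pow_left₀ (by positivity) ?_ _
    have := norm_noiseOp_le hρ0 hρ1 (fun ε : Cube n => signSum ε v) x
    rwa [noiseOp_signSum, norm_smul, Real.norm_of_nonneg hρ0] at this
  rw [hρ2, inv_pow, inv_mul_le_iff₀ (by positivity)] at hle
  rwa [mul_pow]

/-- Cauchy–Schwarz gives `m2² ≤ m1 m3` and `m3² ≤ m2 m4`; the previous bound with `k = 2` gives `m4
≤ 9 m2²`. -/
theorem cubeMean_norm_signSum_sq_le (v : Fin n → X) :
    cubeMean (fun ε : Cube n => ‖signSum ε v‖ ^ 2) ≤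
      9 * cubeMean (fun ε : Cube n => ‖signSum ε v‖) ^ 2 := by
  set S : Cube n → ℝ := fun ε => ‖signSum ε v‖ with hS
  have hS0 : ∀ x, 0 ≤ S x := fun x => norm_nonneg _
  set m1 := cubeMean S
  set m2 := cubeMean (fun x => S x ^ 2)
  set m3 := cubeMean (fun x => S x ^ 3)
  have h0 : 0 ≤ m2 := cubeMean_nonneg fun _ => sq_nonneg _
  have h01 : 0 ≤ m1 := cubeMean_nonneg hS0
  have h03 : 0 ≤ m3 := cubeMean_nonneg fun x => pow_nonneg (hS0 x) _
  have h4 : cubeMean (fun x => S x ^ 4) ≤ 9 * m2 ^ 2 := by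
    have := cubeMean_norm_signSum_pow_le (k := 2) (by norm_num) v
    norm_num [mul_pow] at this
    exact this
  have h13 : m2 ^ 2 ≤ m1 * m3 := by
    have := cubeMean_mul_sq_le (fun x => √(S x)) (fun x => √(S x) * S x)
    have e1 : ∀ x, √(S x) * (√(S x) * S x) = S x ^ 2 := fun x => by
      rw [← mul_assoc, Real.mul_self_sqrt (hS0 x), sq]
    have e2 : ∀ x, √(S x) ^ 2 = S x := fun x => Real.sq_sqrt (hS0 x)
    have e3 : ∀ x, (√(S x) * S x) ^ 2 = S x ^ 3 := fun x => by
      rw [mul_pow, e2]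
      ring
    simpa only [e1, e2, e3] using this
  have h24 : m3 ^ 2 ≤ m2 * cubeMean (fun x => S x ^ 4) := by
    have := cubeMean_mul_sq_le (fun x => S x) (fun x => S x ^ 2)
    have e1 : ∀ x, S x * S x ^ 2 = S x ^ 3 := fun x => by ring
    have e2 : ∀ x, (S x ^ 2) ^ 2 = S x ^ 4 := fun x => by ring
    simpa only [e1, e2] using this
  by_contra! hcon
  have hm2 : 0 < m2 := lt_of_le_of_lt (by positivity) hcon
  have h5 : m2 ^ 4 ≤ m1 ^ 2 * (9 * m2 ^ 3) := by
    calc m2 ^ 4 = (m2 ^ 2) ^ 2 := by ring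
      _ ≤ (m1 * m3) ^ 2 := by gcongr
      _ = m1 ^ 2 * m3 ^ 2 := by ring
      _ ≤ m1 ^ 2 * (m2 * (9 * m2 ^ 2)) := by gcongr; exact h24.trans (by gcongr)
      _ = _ := by ring
  have h6 : m2 ^ 3 * m2 ≤ m2 ^ 3 * (9 * m1 ^ 2) := by linarith
  exact absurd (le_of_mul_le_mul_left h6 (by positivity)) (not_le.mpr hcon)

/-- The Kahane–Khintchine inequality with the optimal order of growth in `q`. -/
theorem cubeMean_norm_signSum_rpow_le {q : ℝ} (hq : 2 ≤ q) (v : Fin n → X) :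
    cubeMean (fun ε : Cube n => ‖signSum ε v‖ ^ q) ≤
      (3 * √(2 * q) * cubeMean (fun ε : Cube n => ‖signSum ε v‖)) ^ q := by
  set S : Cube n → ℝ := fun ε => ‖signSum ε v‖ with hS
  have hS0 : ∀ x, 0 ≤ S x := fun x => norm_nonneg _
  set m1 := cubeMean S
  have h01 : 0 ≤ m1 := cubeMean_nonneg hS0
  -- The least even exponent `2k ≥ q`: its constant `2k - 1` is still at most `2q`, and Jensen
  -- descends from `2k` to `q`.
  set k : ℕ := ⌈q / 2⌉₊
  have hk1 : 1 ≤ k := Nat.one_le_ceil_iff.mpr (by linarith)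
  have hkq : q ≤ 2 * k := by
    have := Nat.le_ceil (q / 2)
    change q / 2 ≤ k at this
    linarith
  have hkq2 : (2 * k - 1 : ℝ) ≤ 2 * q := by
    have := Nat.ceil_lt_add_one (show 0 ≤ q / 2 by linarith)
    change (k : ℝ) < q / 2 + 1 at this
    linarith
  have hk' : (1 : ℝ) ≤ k := by exact_mod_cast hk1
  have hA : cubeMean (fun x => S x ^ (2 * k)) ≤ ((3 * √(2 * q) * m1) ^ 2) ^ k := by
    refine (cubeMean_norm_signSum_pow_le hk1 v).trans ?_
    have hm2 := cubeMean_norm_signSum_sq_le v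
    have h02 : 0 ≤ cubeMean (fun ε : Cube n => ‖signSum ε v‖ ^ 2) :=
      cubeMean_nonneg fun _ => sq_nonneg _
    refine pow_le_pow_left₀ (mul_nonneg (by linarith) h02) ?_ k
    calc _ ≤ (2 * q) * (9 * m1 ^ 2) := by gcongr
      _ = _ := by
        rw [mul_pow, mul_pow, Real.sq_sqrt (by linarith)]
        ring
  have hJ := cubeMean_rpow_le (r := 2 * k / q) (by rw [le_div_iff₀ (by linarith)]; linarith)
    (f := fun x => S x ^ q) (fun x => Real.rpow_nonneg (hS0 x) _)
  have e : ∀ x, (S x ^ q) ^ (2 * k / q : ℝ) = S x ^ (2 * k) := by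
    intro x
    rw [← Real.rpow_mul (hS0 x), mul_div_cancel₀ _ (by linarith : q ≠ 0), ← Real.rpow_natCast]
    push_cast
    rfl
  simp only [e] at hJ
  have h0q : 0 ≤ cubeMean (fun x => S x ^ q) :=
    cubeMean_nonneg fun x => Real.rpow_nonneg (hS0 x) _
  have hB : 0 ≤ 3 * √(2 * q) * m1 := by positivity
  have hfin := hJ.trans hA
  have e2 : ((3 * √(2 * q) * m1) ^ 2) ^ k = ((3 * √(2 * q) * m1) ^ q) ^ (2 * k / q : ℝ) := by
    rw [← Real.rpow_mul hB, mul_div_cancel₀ _ (by linarith : q ≠ 0), ← pow_mul, ← Real.rpow_natCast]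
    push_cast
    rfl
  rw [e2] at hfin
  exact (Real.rpow_le_rpow_iff h0q (Real.rpow_nonneg hB _) (by positivity)).mp hfin

end Kahane

/-! ### Sparsified Rademacher sums and cotype. -/

/-- The law of a selector of mean `τ` together with an independent uniform sign. -/
noncomputable def sparseWeight (τ : ℝ) (a : Bool × ℤˣ) : ℝ :=
  (if a.1 then τ else 1 - τ) / 2

/-- The product of the selector and the sign. -/
noncomputable def sparseCoeff (a : Bool × ℤˣ) : ℝ :=
  if a.1 then (((a.2 : ℤˣ) : ℤ) : ℝ) else 0

theorem sparseWeight_nonneg {τ : ℝ} (h0 : 0 ≤ τ) (h1 : τ ≤ 1) (a : Bool × ℤˣ) :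
    0 ≤ sparseWeight τ a := by
  unfold sparseWeight
  split_ifs <;> linarith

theorem sum_sparseWeight (τ : ℝ) : ∑ a, sparseWeight τ a = 1 := by
  rw [Fintype.sum_prod_type]
  simp only [sum_units_int, Fintype.sum_bool, sparseWeight]
  norm_num

theorem sum_prod_sparseWeight {n : ℕ} (τ : ℝ) :
    ∑ ω : Fin n → Bool × ℤˣ, ∏ k, sparseWeight τ (ω k) = 1 :=
  sum_prod_eq_one (fun _ => sparseWeight τ) fun _ => sum_sparseWeight τ

/-- The law of a class in `{0, …, N}` and an independent sign, where each nonzero class has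
probability `τ`. -/
noncomputable def classWeight (N : ℕ) (τ : ℝ) (a : Fin (N + 1) × ℤˣ) : ℝ :=
  (if a.1 = 0 then 1 - N * τ else τ) / 2

theorem classWeight_nonneg {N : ℕ} {τ : ℝ} (h0 : 0 ≤ τ) (h1 : N * τ ≤ 1)
    (a : Fin (N + 1) × ℤˣ) : 0 ≤ classWeight N τ a := by
  unfold classWeight
  split_ifs <;> linarith

theorem sum_class (N : ℕ) (τ : ℝ) (e : ℤˣ) : ∑ c, classWeight N τ (c, e) = 1 / 2 := by
  simp only [classWeight, Fin.sum_univ_succ, Fin.succ_ne_zero, if_true, if_false]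
  simp only [sum_const, card_univ, Fintype.card_fin, nsmul_eq_mul]
  ring

theorem sum_classWeight (N : ℕ) (τ : ℝ) : ∑ a, classWeight N τ a = 1 := by
  rw [Fintype.sum_prod_type_right]
  simp only [sum_class, sum_units_int]
  norm_num

theorem sum_classWeight_selector {N : ℕ} (τ : ℝ) (i : Fin N) (b : Bool × ℤˣ) :
    ∑ a : Fin (N + 1) × ℤˣ with (decide (a.1 = i.succ), a.2) = b, classWeight N τ a =
      sparseWeight τ b := by
  obtain ⟨b, e⟩ := b
  rw [Finset.sum_filter, Fintype.sum_prod_type]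
  simp only [Prod.mk.injEq, ite_and]
  have h1 : ∀ c : Fin (N + 1), (∑ e' : ℤˣ, if decide (c = i.succ) = b then
      if e' = e then classWeight N τ (c, e') else 0 else 0) =
      if decide (c = i.succ) = b then classWeight N τ (c, e) else 0 := by
    intro c
    split_ifs
    · exact Finset.sum_ite_eq' univ e _ |>.trans (if_pos (Finset.mem_univ e))
    · exact Finset.sum_const_zero
  rw [Finset.sum_congr rfl fun c _ => h1 c]
  cases b
  · have h2 : ∀ c : Fin (N + 1),
        (if decide (c = i.succ) = false then classWeight N τ (c, e) else 0) =
          classWeight N τ (c, e) - if c = i.succ then classWeight N τ (c, e) else 0 := by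
      intro c
      by_cases h : c = i.succ <;> simp [h]
    rw [Finset.sum_congr rfl fun c _ => h2 c, Finset.sum_sub_distrib, sum_class,
      Finset.sum_ite_eq' univ i.succ]
    simp [classWeight, sparseWeight, Fin.succ_ne_zero]
    ring
  · simp [classWeight, sparseWeight, Fin.succ_ne_zero]

/-- The sign is uniform and independent of the class, so multiplying it by a sign depending on the
class leaves it uniform. -/
theorem sum_classWeight_sign {N : ℕ} (τ : ℝ) (ε : Cube (N + 1)) (e : ℤˣ) :
    ∑ a : Fin (N + 1) × ℤˣ with ε a.1 * a.2 = e, classWeight N τ a = 1 / 2 := by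
  rw [Finset.sum_filter, Fintype.sum_prod_type, ← sum_class N τ 1]
  refine Finset.sum_congr rfl fun c _ => ?_
  rw [sum_units_int]
  simp only [classWeight]
  rcases Int.units_eq_one_or (ε c) with h | h <;> rcases Int.units_eq_one_or e with h' | h' <;>
    subst h' <;> simp [h]

section Cotype

variable {X : Type*} [NormedAddCommGroup X] [NormedSpace ℝ X] {n : ℕ}

/-- Cotype makes randomly sparsified Rademacher sums small: this is the cotype inequality applied
to the partial sums over the classes of a random partition. -/
theorem IsCotypeBound.sparse {q C τ : ℝ} (hC : IsCotypeBound X q C) {N : ℕ} (h0 : 0 ≤ τ)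
    (hN : N * τ ≤ 1) (v : Fin n → X) :
    N * ∑ ω : Fin n → Bool × ℤˣ,
        (∏ k, sparseWeight τ (ω k)) * ‖∑ j, sparseCoeff (ω j) • v j‖ ^ q ≤
      C ^ q * cubeMean fun ε : Cube n => ‖signSum ε v‖ ^ q := by
  set M := cubeMean fun ε : Cube n => ‖signSum ε v‖ ^ q with hM
  let W : (Fin n → Fin (N + 1) × ℤˣ) → ℝ := fun ω => ∏ k, classWeight N τ (ω k)
  have hW : ∀ ω, 0 ≤ W ω := fun ω => Finset.prod_nonneg fun k _ => classWeight_nonneg h0 hN _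
  let w : (Fin n → Fin (N + 1) × ℤˣ) → Fin (N + 1) → X := fun ω i =>
    ∑ j, sparseCoeff (decide ((ω j).1 = i), (ω j).2) • v j
  -- Each nonzero class sum has the law of the sparsified sum.
  have h1 : ∀ i : Fin N, ∑ ω : Fin n → Bool × ℤˣ,
      (∏ k, sparseWeight τ (ω k)) * ‖∑ j, sparseCoeff (ω j) • v j‖ ^ q =
        ∑ ω, W ω * ‖w ω i.succ‖ ^ q := fun i =>
    (sum_prod_smul_comp (fun a : Fin (N + 1) × ℤˣ => (decide (a.1 = i.succ), a.2))
      (fun _ => classWeight N τ) (fun _ => sparseWeight τ)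
      (fun _ b => sum_classWeight_selector τ i b)
      (fun ω => ‖∑ j, sparseCoeff (ω j) • v j‖ ^ q)).symm
  -- Signed class sums reassemble into a full Rademacher sum whose signs, for fixed `ε`, are again
  -- uniform.
  have h2 : ∀ (ω : Fin n → Fin (N + 1) × ℤˣ) (ε : Cube (N + 1)),
      signSum ε (w ω) = signSum (fun j => ε (ω j).1 * (ω j).2) v := by
    intro ω ε
    simp only [signSum_eq, w, Finset.smul_sum, smul_smul]
    rw [Finset.sum_comm]
    refine Finset.sum_congr rfl fun j _ => ?_
    rw [← Finset.sum_smul]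
    congr 1
    simp [sparseCoeff]
  have h3 : ∀ ε : Cube (N + 1), ∑ ω, W ω * ‖signSum ε (w ω)‖ ^ q = M := by
    intro ε
    simp only [h2]
    rw [hM, cubeMean_eq_sum_prod]
    exact sum_prod_smul_comp (fun a : Fin (N + 1) × ℤˣ => ε a.1 * a.2)
      (fun _ => classWeight N τ) (fun _ _ => 1 / 2)
      (fun _ e => sum_classWeight_sign τ ε e) (fun x => ‖signSum x v‖ ^ q)
  calc _ = ∑ i : Fin N, ∑ ω, W ω * ‖w ω i.succ‖ ^ q := by
        rw [← Finset.sum_congr rfl fun i _ => h1 i]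
        simp
    _ = ∑ ω, W ω * ∑ i : Fin N, ‖w ω i.succ‖ ^ q := by
        rw [Finset.sum_comm]
        simp only [Finset.mul_sum]
    _ ≤ ∑ ω, W ω * (C ^ q * cubeMean fun ε : Cube (N + 1) => ‖signSum ε (w ω)‖ ^ q) := by
        refine Finset.sum_le_sum fun ω _ => mul_le_mul_of_nonneg_left ?_ (hW ω)
        -- Cotype is used for all `N + 1` classes; the term of the residual class `0` is discarded.
        refine le_trans ?_ (hC.2 _ (w ω))
        rw [Fin.sum_univ_succ]
        exact le_add_of_nonneg_left (Real.rpow_nonneg (norm_nonneg _) _)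
    _ = C ^ q * cubeMean fun ε : Cube (N + 1) => ∑ ω, W ω * ‖signSum ε (w ω)‖ ^ q := by
        rw [cubeMean_sum, Finset.mul_sum]
        refine Finset.sum_congr rfl fun ω _ => ?_
        rw [cubeMean_const_mul]
        ring
    _ = _ := by
        simp only [h3, cubeMean_const]

/-- Sparsification with `1 ≤ p ≤ q` and the right-hand side in `Lᵖ`. -/
theorem IsCotypeBound.sparse_rpow {p q C τ : ℝ} (hC : IsCotypeBound X q C) (hq : 2 ≤ q)
    (hp : 1 ≤ p) (hpq : p ≤ q) (h0 : 0 < τ) (h1 : τ ≤ 1) (v : Fin n → X) :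
    ∑ ω : Fin n → Bool × ℤˣ,
        (∏ k, sparseWeight τ (ω k)) * ‖∑ j, sparseCoeff (ω j) • v j‖ ^ p ≤
      (6 * √2 * √q * C * τ ^ (1 / q)) ^ p *
        cubeMean fun ε : Cube n => ‖signSum ε v‖ ^ p := by
  have hq0 : 0 < q := by linarith
  have hp0 : 0 < p := by linarith
  have hC0 := hC.1
  set m1 := cubeMean fun ε : Cube n => ‖signSum ε v‖
  have hm1 : 0 ≤ m1 := cubeMean_nonneg fun _ => norm_nonneg _
  set Z : (Fin n → Bool × ℤˣ) → ℝ := fun ω => ‖∑ j, sparseCoeff (ω j) • v j‖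
  have hZ : ∀ ω, 0 ≤ Z ω := fun ω => norm_nonneg _
  have hW : ∀ ω : Fin n → Bool × ℤˣ, 0 ≤ ∏ k, sparseWeight τ (ω k) := fun ω =>
    Finset.prod_nonneg fun k _ => sparseWeight_nonneg h0.le h1 _
  set Eq := ∑ ω : Fin n → Bool × ℤˣ, (∏ k, sparseWeight τ (ω k)) * Z ω ^ q
  set Ep := ∑ ω : Fin n → Bool × ℤˣ, (∏ k, sparseWeight τ (ω k)) * Z ω ^ p
  have hEp : 0 ≤ Ep := Finset.sum_nonneg fun ω _ => mul_nonneg (hW ω) (Real.rpow_nonneg (hZ ω) _)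
  have hEq : 0 ≤ Eq := Finset.sum_nonneg fun ω _ => mul_nonneg (hW ω) (Real.rpow_nonneg (hZ ω) _)
  set B := C * (3 * √(2 * q) * m1) with hB
  have hB0 : 0 ≤ B := by positivity
  have hA : Eq ≤ 2 * τ * B ^ q := by
    -- Since `τ ≤ 1`, the integer `N = ⌊1 / τ⌋₊` is at least `1`, so `1 / τ < N + 1 ≤ 2N`: rounding
    -- costs only a factor `2`.
    have hs := hC.sparse (N := ⌊1 / τ⌋₊) h0.le
      ((le_div_iff₀ h0).mp (Nat.floor_le (by positivity))) v
    have hN1 : 1 ≤ ⌊1 / τ⌋₊ := Nat.le_floor (by simpa using (one_le_inv₀ h0).mpr h1)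
    have hN1' : (1 : ℝ) ≤ (⌊1 / τ⌋₊ : ℝ) := by exact_mod_cast hN1
    have hN2 : 1 / τ ≤ 2 * (⌊1 / τ⌋₊ : ℝ) := by
      have := Nat.lt_floor_add_one (1 / τ)
      linarith
    rw [div_le_iff₀ h0] at hN2
    have hK := cubeMean_norm_signSum_rpow_le hq v
    have hs2 : (⌊1 / τ⌋₊ : ℝ) * Eq ≤ B ^ q := by
      refine hs.trans ?_
      rw [hB, Real.mul_rpow hC0 (by positivity)]
      exact mul_le_mul_of_nonneg_left hK (Real.rpow_nonneg hC0 _)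
    calc Eq ≤ (2 * (⌊1 / τ⌋₊ : ℝ) * τ) * Eq := le_mul_of_one_le_left hEq hN2
      _ = 2 * τ * ((⌊1 / τ⌋₊ : ℝ) * Eq) := by ring
      _ ≤ _ := by gcongr
  have hJ : Ep ^ (q / p) ≤ Eq := by
    have h := Real.rpow_arith_mean_le_arith_mean_rpow univ
      (fun ω : Fin n → Bool × ℤˣ => ∏ k, sparseWeight τ (ω k)) (fun ω => Z ω ^ p)
      (fun ω _ => hW ω) (sum_prod_sparseWeight τ) (fun ω _ => Real.rpow_nonneg (hZ ω) _)
      (p := q / p) (by rwa [le_div_iff₀ hp0, one_mul])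
    refine h.trans_eq (Finset.sum_congr rfl fun ω _ => ?_)
    rw [← Real.rpow_mul (hZ ω), mul_div_cancel₀ _ hp0.ne']
  have hD : (2 * τ * B ^ q : ℝ) ≤ ((2 * τ ^ (1 / q) * B) ^ p) ^ (q / p) := by
    rw [← Real.rpow_mul (by positivity), mul_div_cancel₀ _ hp0.ne',
      Real.mul_rpow (by positivity) hB0,
      Real.mul_rpow (x := 2) (by positivity) (by positivity), ← Real.rpow_mul h0.le, one_div_mul_cancel hq0.ne', Real.rpow_one]
    gcongr
    calc (2 : ℝ) = 2 ^ (1 : ℝ) := by simp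
      _ ≤ _ := Real.rpow_le_rpow_of_exponent_le (by norm_num) (by linarith)
  have hE : Ep ≤ (2 * τ ^ (1 / q) * B) ^ p :=
    (Real.rpow_le_rpow_iff hEp (by positivity) (by positivity)).mp ((hJ.trans hA).trans hD)
  refine hE.trans ?_
  have e : 2 * τ ^ (1 / q) * B = (6 * √2 * √q * C * τ ^ (1 / q)) * m1 := by
    rw [hB, Real.sqrt_mul (by norm_num)]
    ring
  rw [e, Real.mul_rpow (by positivity) hm1]
  gcongr
  exact cubeMean_rpow_le hp fun _ => norm_nonneg _

end Cotype

/-- Admissible constants form a closed set, so the infimum is attained. -/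
theorem isCotypeBound_cotypeConst {X : Type*} [NormedAddCommGroup X] {q : ℝ} (hq : 0 < q) (h : HasCotype X q) :
    IsCotypeBound X q (cotypeConst X q) := by
  have hne : {C : ℝ | IsCotypeBound X q C}.Nonempty := h
  have hbd : BddBelow {C : ℝ | IsCotypeBound X q C} := ⟨0, fun C hC => hC.1⟩
  have hcl : IsClosed {C : ℝ | IsCotypeBound X q C} := by
    simp only [IsCotypeBound, Set.ofPred_and, Set.ofPred_forall]
    refine isClosed_Ici.inter (isClosed_iInter fun m => isClosed_iInter fun v => ?_)
    exact isClosed_le continuous_const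
      ((Real.continuous_rpow_const hq.le).mul continuous_const)
  exact hcl.csInf_mem hne hbd

/-! ### The derivative of the noise operator in the noise parameter. -/

/-- The multiplicative noise determined by a selector and a sign. -/
def selectedSign (a : Bool × ℤˣ) : ℤˣ := if a.1 then a.2 else 1

/-- The contribution of the `j`-th coordinate to the derivative of `noiseWeight` in `ρ`. -/
noncomputable def noiseWeightDeriv {n : ℕ} (ρ : ℝ) (j : Fin n) (y : Cube n) : ℝ :=
  (∏ k ∈ univ.erase j, (1 + ρ * (((y k : ℤˣ) : ℤ) : ℝ)) / 2) * ((((y j : ℤˣ) : ℤ) : ℝ) / 2)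

theorem hasDerivAt_noiseWeight {n : ℕ} (y : Cube n) (ρ : ℝ) :
    HasDerivAt (fun ρ => noiseWeight ρ y) (∑ j, noiseWeightDeriv ρ j y) ρ := by
  have h := HasDerivAt.fun_finsetProd (u := (univ : Finset (Fin n)))
    (f := fun j (ρ : ℝ) => (1 + ρ * (((y j : ℤˣ) : ℤ) : ℝ)) / 2)
    (f' := fun j => (((y j : ℤˣ) : ℤ) : ℝ) / 2) (x := ρ) (fun j _ => by
      have := (((hasDerivAt_id ρ).mul_const (((y j : ℤˣ) : ℤ) : ℝ)).const_add 1).div_const 2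
      simpa using this)
  simpa [noiseWeight, noiseWeightDeriv] using h

section Deriv

variable {n : ℕ} {E : Type*} [AddCommGroup E] [Module ℝ E]

/-- The weight is odd in `y j`, so only the part of `f` odd in coordinate `j`, namely `cubeDeriv j
f`, contributes. -/
theorem sum_noiseWeightDeriv_smul_cubeDeriv (ρ : ℝ) (j : Fin n) (f : Cube n → E) (x : Cube n) :
    ∑ y, noiseWeightDeriv ρ j y • cubeDeriv j f (y * x) =
      ∑ y, noiseWeightDeriv ρ j y • f (y * x) := by
  have hinv : Function.Involutive fun y : Cube n => Function.update y j (-y j) := by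
    intro y
    simp
  have hodd : ∀ y : Cube n, noiseWeightDeriv ρ j (Function.update y j (-y j)) =
      -noiseWeightDeriv ρ j y := by
    intro y
    unfold noiseWeightDeriv
    have h : ∀ k ∈ univ.erase j,
        (1 + ρ * (((Function.update y j (-y j) k : ℤˣ) : ℤ) : ℝ)) / 2 =
          (1 + ρ * (((y k : ℤˣ) : ℤ) : ℝ)) / 2 := by
      intro k hk
      rw [Function.update_of_ne (Finset.ne_of_mem_erase hk)]
    rw [Finset.prod_congr rfl h, Function.update_self]
    push_cast
    ring
  have hmul : ∀ y : Cube n, Function.update (y * x) j (-(y * x) j) =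
      Function.update y j (-y j) * x := by
    intro y
    funext k
    by_cases hk : k = j
    · subst hk
      simp
    · simp [Function.update_of_ne hk]
  have hflip : ∑ y, noiseWeightDeriv ρ j y • f (Function.update y j (-y j) * x) =
      -∑ y, noiseWeightDeriv ρ j y • f (y * x) := by
    rw [← Equiv.sum_comp hinv.toPerm, ← Finset.sum_neg_distrib]
    refine Finset.sum_congr rfl fun y _ => ?_
    have h2 : Function.update (Function.update y j (-y j)) j (-Function.update y j (-y j) j) = y :=
      hinv y
    rw [Function.Involutive.coe_toPerm, h2, hodd, neg_smul]
  simp only [cubeDeriv, hmul, smul_comm _ (1 / 2 : ℝ), ← Finset.smul_sum, smul_sub,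
    Finset.sum_sub_distrib]
  rw [hflip]
  module

theorem sum_sparseWeight_selectedSign (ρ : ℝ) (e : ℤˣ) :
    ∑ a with selectedSign a = e, sparseWeight (1 - ρ) a = (1 + ρ * (((e : ℤˣ) : ℤ) : ℝ)) / 2 := by
  rw [Finset.sum_filter, Fintype.sum_prod_type]
  simp only [sum_units_int, Fintype.sum_bool, sparseWeight, selectedSign]
  rcases Int.units_eq_one_or e with rfl | rfl <;> simp <;> ring

/-- The coefficient vanishes unless the coordinate is resampled, and then it equals the new sign.
The result is `1 - ρ` times the `ρ`-derivative of the one-coordinate noise density. -/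
theorem sum_sparseWeight_mul_sparseCoeff (ρ : ℝ) (e : ℤˣ) :
    ∑ a with selectedSign a = e, sparseWeight (1 - ρ) a * sparseCoeff a =
      (1 - ρ) * ((((e : ℤˣ) : ℤ) : ℝ) / 2) := by
  rw [Finset.sum_filter, Fintype.sum_prod_type]
  simp only [sum_units_int, Fintype.sum_bool, sparseWeight, selectedSign, sparseCoeff]
  rcases Int.units_eq_one_or e with rfl | rfl <;> simp <;> ring

/-- The derivative of the noise operator is an average of randomly sparsified gradients. -/
theorem noiseOp_deriv_formula (ρ : ℝ) (f : Cube n → E) (x : Cube n) :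
    (1 - ρ) • ∑ y, (∑ j, noiseWeightDeriv ρ j y) • f (y * x) =
      ∑ ω : Fin n → Bool × ℤˣ, (∏ k, sparseWeight (1 - ρ) (ω k)) •
        ∑ j, sparseCoeff (ω j) • cubeDeriv j f ((fun k => selectedSign (ω k)) * x) := by
  have hj : ∀ j : Fin n, ∑ ω : Fin n → Bool × ℤˣ, (∏ k, sparseWeight (1 - ρ) (ω k)) •
      sparseCoeff (ω j) • cubeDeriv j f ((fun k => selectedSign (ω k)) * x) =
        (1 - ρ) • ∑ y, noiseWeightDeriv ρ j y • f (y * x) := by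
    intro j
    have h := sum_prod_smul_comp (n := n) selectedSign
      (fun k a => sparseWeight (1 - ρ) a * if k = j then sparseCoeff a else 1)
      (fun k e => if k = j then (1 - ρ) * ((((e : ℤˣ) : ℤ) : ℝ) / 2)
        else (1 + ρ * (((e : ℤˣ) : ℤ) : ℝ)) / 2)
      (fun k e => by
        by_cases hk : k = j
        · simp only [hk, if_true]
          exact sum_sparseWeight_mul_sparseCoeff ρ e
        · simp only [hk, if_false, mul_one]
          exact sum_sparseWeight_selectedSign ρ e)
      (fun y => cubeDeriv j f (y * x))
    simp only [Finset.prod_mul_distrib, Finset.prod_ite_eq', Finset.mem_univ, if_true] at h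
    simp only [smul_smul]
    rw [h, ← sum_noiseWeightDeriv_smul_cubeDeriv, Finset.smul_sum]
    refine Finset.sum_congr rfl fun y _ => ?_
    rw [smul_smul]
    congr 1
    rw [← Finset.mul_prod_erase univ _ (Finset.mem_univ j), if_pos rfl, noiseWeightDeriv]
    rw [Finset.prod_congr rfl fun k hk => if_neg (Finset.ne_of_mem_erase hk)]
    ring
  simp only [Finset.smul_sum (N := E) (r := (∏ k, sparseWeight (1 - ρ) _ : ℝ))]
  rw [Finset.sum_comm, Finset.sum_congr rfl fun j _ => hj j, ← Finset.smul_sum, Finset.sum_comm]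
  simp only [Finset.sum_smul]

end Deriv

/-! ### Distance from a function to its noised version. -/

section Bound

variable {X : Type*} [NormedAddCommGroup X] [NormedSpace ℝ X] {n : ℕ}

/-- After Jensen, the shift of `x` by the random signs is removed by translation invariance of the
uniform measure. The coefficients are thus decoupled from the base point, and sparsification applies
for each fixed `x`. -/
theorem cubeMean_norm_noiseOp_deriv_le {p q C ρ : ℝ} (hC : IsCotypeBound X q C) (hq : 2 ≤ q)
    (hp : 1 ≤ p) (hpq : p ≤ q) (h0 : 0 ≤ ρ) (h1 : ρ < 1) (f : Cube n → X) :
    cubeMean (fun x => ‖∑ y, (∑ j, noiseWeightDeriv ρ j y) • f (y * x)‖ ^ p) ≤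
      (6 * √2 * √q * C * (1 - ρ) ^ (1 / q - 1) * cubeGradNorm p f) ^ p := by
  have hτ : 0 < 1 - ρ := by linarith
  have hC0 := hC.1
  have hp0 : 0 < p := by linarith
  set A := 6 * √2 * √q * C * (1 - ρ) ^ (1 / q) with hA
  have hA0 : 0 ≤ A := by positivity
  set Gp := cubeMean fun x : Cube n =>
    cubeMean fun x' : Cube n => ‖signSum x' fun j => cubeDeriv j f x‖ ^ p with hGp
  have hGp0 : 0 ≤ Gp := cubeMean_nonneg fun _ => cubeMean_nonneg fun _ =>
    Real.rpow_nonneg (norm_nonneg _) _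
  have hW : ∀ ω : Fin n → Bool × ℤˣ, 0 ≤ ∏ k, sparseWeight (1 - ρ) (ω k) := fun ω =>
    Finset.prod_nonneg fun k _ => sparseWeight_nonneg hτ.le (by linarith) _
  set Z : (Fin n → Bool × ℤˣ) → Cube n → ℝ := fun ω x =>
    ‖∑ j, sparseCoeff (ω j) • cubeDeriv j f x‖ with hZ
  have hpt : ∀ x : Cube n,
      ((1 - ρ) * ‖∑ y, (∑ j, noiseWeightDeriv ρ j y) • f (y * x)‖) ^ p ≤
        ∑ ω : Fin n → Bool × ℤˣ, (∏ k, sparseWeight (1 - ρ) (ω k)) *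
          Z ω ((fun k => selectedSign (ω k)) * x) ^ p := by
    intro x
    have e : (1 - ρ) * ‖∑ y, (∑ j, noiseWeightDeriv ρ j y) • f (y * x)‖ =
        ‖(1 - ρ) • ∑ y, (∑ j, noiseWeightDeriv ρ j y) • f (y * x)‖ := by
      rw [norm_smul, Real.norm_of_nonneg hτ.le]
    rw [e, noiseOp_deriv_formula]
    refine le_trans ?_ (Real.rpow_arith_mean_le_arith_mean_rpow univ
      (fun ω : Fin n → Bool × ℤˣ => ∏ k, sparseWeight (1 - ρ) (ω k)) _
      (fun ω _ => hW ω) (sum_prod_sparseWeight _) (fun ω _ => norm_nonneg _) hp)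
    refine Real.rpow_le_rpow (norm_nonneg _) ?_ hp0.le
    refine (norm_sum_le _ _).trans (Finset.sum_le_sum fun ω _ => ?_)
    rw [norm_smul, Real.norm_of_nonneg (hW ω)]
  have hmean : (1 - ρ) ^ p *
      cubeMean (fun x => ‖∑ y, (∑ j, noiseWeightDeriv ρ j y) • f (y * x)‖ ^ p) ≤ A ^ p * Gp := by
    calc _ = cubeMean fun x : Cube n =>
          ((1 - ρ) * ‖∑ y, (∑ j, noiseWeightDeriv ρ j y) • f (y * x)‖) ^ p := by
          rw [← cubeMean_const_mul]
          refine congrArg cubeMean (funext fun x => ?_)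
          rw [Real.mul_rpow hτ.le (norm_nonneg _)]
      _ ≤ cubeMean fun x : Cube n => ∑ ω : Fin n → Bool × ℤˣ,
            (∏ k, sparseWeight (1 - ρ) (ω k)) *
              Z ω ((fun k => selectedSign (ω k)) * x) ^ p := cubeMean_mono hpt
      _ = cubeMean fun x : Cube n => ∑ ω : Fin n → Bool × ℤˣ,
            (∏ k, sparseWeight (1 - ρ) (ω k)) * Z ω x ^ p := by
          rw [cubeMean_sum, cubeMean_sum]
          refine Finset.sum_congr rfl fun ω _ => ?_
          exact cubeMean_mul_left (fun k => selectedSign (ω k))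
            (fun x => (∏ k, sparseWeight (1 - ρ) (ω k)) * Z ω x ^ p)
      _ ≤ cubeMean fun x : Cube n => A ^ p *
            cubeMean fun x' : Cube n => ‖signSum x' fun j => cubeDeriv j f x‖ ^ p :=
          cubeMean_mono fun x => hC.sparse_rpow hq hp hpq hτ (by linarith) _
      _ = _ := cubeMean_const_mul _ _
  have hG : cubeGradNorm p f ^ p = Gp := by
    rw [cubeGradNorm, ← Real.rpow_mul hGp0, one_div_mul_cancel hp0.ne', Real.rpow_one]
  have hG0 : 0 ≤ cubeGradNorm p f := Real.rpow_nonneg hGp0 _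
  have e : 6 * √2 * √q * C * (1 - ρ) ^ (1 / q - 1) * cubeGradNorm p f =
      (1 - ρ)⁻¹ * (A * cubeGradNorm p f) := by
    rw [hA, Real.rpow_sub hτ, Real.rpow_one]
    field_simp
  rw [e, Real.mul_rpow (by positivity) (by positivity), Real.mul_rpow hA0 hG0, hG,
    Real.inv_rpow hτ.le]
  rwa [← inv_mul_le_iff₀ (by positivity), inv_inv]

theorem sum_rpow_le_of_cubeMean_le {p c : ℝ} {g : Cube n → ℝ} (hp : 0 < p) (hc : 0 ≤ c)
    (hg : ∀ x, 0 ≤ g x) (h : cubeMean (fun x => g x ^ p) ≤ c ^ p) :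
    (∑ x, g x ^ p) ^ (1 / p) ≤ ((2 : ℝ) ^ n) ^ (1 / p) * c := by
  have h2 : ((2 : ℝ) ^ n)⁻¹ * ∑ x, g x ^ p ≤ c ^ p := h
  rw [inv_mul_le_iff₀ (by positivity)] at h2
  calc (∑ x, g x ^ p) ^ (1 / p) ≤ ((2 : ℝ) ^ n * c ^ p) ^ (1 / p) := by
        refine Real.rpow_le_rpow (Finset.sum_nonneg fun x _ => Real.rpow_nonneg (hg x) _) h2 ?_
        positivity
    _ = _ := by
        rw [Real.mul_rpow (by positivity) (by positivity), ← Real.rpow_mul hc,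
          mul_one_div_cancel hp.ne', Real.rpow_one]

/-- Quantitative approximation by the noise operator in terms of the gradient. -/
theorem cubeLpNorm_sub_noiseOp_le {p q C ρ : ℝ} (hC : IsCotypeBound X q C) (hq : 2 ≤ q)
    (hp : 1 ≤ p) (hpq : p ≤ q) (h0 : 0 ≤ ρ) (h1 : ρ ≤ 1) (f : Cube n → X) :
    cubeLpNorm p (fun x => f x - noiseOp ρ f x) ≤
      6 * √2 * √q * C * q * (1 - ρ) ^ (1 / q) * cubeGradNorm p f := by
  have hp0 : 0 < p := by linarith
  have hq0 : 0 < q := by linarith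
  have hC0 := hC.1
  have hG0 : 0 ≤ cubeGradNorm p f := Real.rpow_nonneg (cubeMean_nonneg fun _ =>
    cubeMean_nonneg fun _ => Real.rpow_nonneg (norm_nonneg _) _) _
  have : Fact (1 ≤ ENNReal.ofReal p) := ⟨by simpa using hp⟩
  have htr : (ENNReal.ofReal p).toReal = p := ENNReal.toReal_ofReal hp0.le
  -- `PiLp` uses counting measure; `N` converts to the normalized mean.
  set N := ((2 : ℝ) ^ n) ^ (1 / p) with hN
  have hN0 : 0 < N := by positivity
  set K := 6 * √2 * √q * C * cubeGradNorm p f with hK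
  have hK0 : 0 ≤ K := by positivity
  have hnorm : ∀ F : PiLp (ENNReal.ofReal p) (fun _ : Cube n => X), ‖F‖ = (∑ x, ‖F x‖ ^ p) ^ (1 / p) := by
    intro F
    rw [PiLp.norm_eq_sum (by rw [htr]; exact hp0), htr]
  let T : Cube n → PiLp (ENNReal.ofReal p) (fun _ : Cube n => X) := fun y => WithLp.toLp _ fun x => f (y * x)
  let γ : ℝ → PiLp (ENNReal.ofReal p) (fun _ : Cube n => X) := fun r => ∑ y, noiseWeight r y • T y
  let γ' : ℝ → PiLp (ENNReal.ofReal p) (fun _ : Cube n => X) := fun r => ∑ y, (∑ j, noiseWeightDeriv r j y) • T y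
  have hγ : ∀ r, HasDerivAt γ (γ' r) r := fun r =>
    HasDerivAt.fun_sum fun y _ => (hasDerivAt_noiseWeight y r).smul_const (T y)
  have hγx : ∀ r x, (γ r) x = noiseOp r f x := by
    intro r x
    simp [γ, T, noiseOp, WithLp.ofLp_sum]
  have hγ'x : ∀ r x, (γ' r) x = ∑ y, (∑ j, noiseWeightDeriv r j y) • f (y * x) := by
    intro r x
    simp [γ', T, WithLp.ofLp_sum]
  have hbound : ∀ r ∈ Set.Ico ρ 1, ‖γ' r‖ ≤ N * K * (1 - r) ^ (1 / q - 1) := by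
    intro r hr
    have hr1 : 0 < 1 - r := by linarith [hr.2]
    rw [hnorm]
    simp only [hγ'x]
    have := sum_rpow_le_of_cubeMean_le hp0 (by positivity) (fun x => norm_nonneg _)
      (cubeMean_norm_noiseOp_deriv_le hC hq hp hpq (h0.trans hr.1) hr.2 f)
    refine this.trans_eq ?_
    rw [hK]
    ring
  -- An antiderivative of the derivative bound, vanishing at `ρ`. It is continuous up to `r = 1`,
  -- where the bound itself may be singular.
  let B : ℝ → ℝ := fun r => N * K * q * ((1 - ρ) ^ (1 / q) - (1 - r) ^ (1 / q))
  have hBc : Continuous B := by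
    refine continuous_const.mul (continuous_const.sub ?_)
    exact (continuous_const.sub continuous_id).rpow_const fun _ => Or.inr (by positivity)
  have hBd : ∀ r ∈ Set.Ico ρ 1, HasDerivAt B (N * K * (1 - r) ^ (1 / q - 1)) r := by
    intro r hr
    have hr1 : 0 < 1 - r := by linarith [hr.2]
    have h := (((hasDerivAt_id r).const_sub 1).rpow_const (p := 1 / q)
      (Or.inl hr1.ne')).const_sub ((1 - ρ) ^ (1 / q)) |>.const_mul (N * K * q)
    refine h.congr_deriv ?_
    simp only [id]
    field_simp
  have hmain := image_norm_le_of_norm_deriv_right_le_deriv_boundary' (a := ρ) (b := 1)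
    (f := fun r => γ r - γ ρ) (f' := γ') (B := B)
    (B' := fun r => N * K * (1 - r) ^ (1 / q - 1))
    (fun r _ => ((hγ r).sub_const _).continuousAt.continuousWithinAt)
    (fun r _ => ((hγ r).sub_const _).hasDerivWithinAt)
    (by simp [B]) hBc.continuousOn (fun r hr => (hBd r hr).hasDerivWithinAt) hbound
    (Set.right_mem_Icc.mpr h1)
  have hB1 : B 1 = N * (6 * √2 * √q * C * q * (1 - ρ) ^ (1 / q) * cubeGradNorm p f) := by
    simp only [B, sub_self, Real.zero_rpow (one_div_ne_zero hq0.ne'), hK]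
    ring
  have hL : ‖γ 1 - γ ρ‖ = N * cubeLpNorm p (fun x => f x - noiseOp ρ f x) := by
    rw [hnorm]
    simp only [PiLp.sub_apply, hγx, noiseOp_one]
    rw [cubeLpNorm, cubeMean, smul_eq_mul, Real.mul_rpow (by positivity)
      (Finset.sum_nonneg fun _ _ => Real.rpow_nonneg (norm_nonneg _) _),
      Real.inv_rpow (by positivity), ← hN, ← mul_assoc, mul_inv_cancel₀ hN0.ne', one_mul]
  rw [hB1] at hmain
  exact le_of_mul_le_mul_left (hL.symm.le.trans hmain) hN0

end Bound

/-! ### Energy decay under noise. -/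

section Decay

variable {n : ℕ}

/-- Self-adjointness and the semigroup law give `‖T_ρ g‖₂² = ⟨g, T_{ρ²} g⟩`; then Cauchy–Schwarz. -/
theorem cubeMean_noiseOp_sq_sq_le (ρ : ℝ) (g : Cube n → ℝ) :
    cubeMean (fun x => noiseOp ρ g x ^ 2) ^ 2 ≤
      cubeMean (fun x => g x ^ 2) * cubeMean (fun x => noiseOp (ρ ^ 2) g x ^ 2) := by
  rw [cubeMean_noiseOp_sq]
  exact cubeMean_mul_sq_le _ _

/-- Interpolated hypercontractivity between `L¹` and `L²`. -/
theorem cubeMean_noiseOp_sq_sq_le_mean {ρ : ℝ} (hρ : ρ ^ 2 * 3 ≤ 1) {g : Cube n → ℝ}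
    (hg : ∀ x, 0 ≤ g x) :
    cubeMean (fun x => noiseOp ρ g x ^ 2) ^ 2 ≤ cubeMean g ^ 2 * cubeMean (fun x => g x ^ 2) := by
  set h := noiseOp ρ g
  set u := noiseOp ρ h with hu
  set H := cubeMean (fun x => h x ^ 2)
  have hH0 : 0 ≤ H := cubeMean_nonneg fun _ => sq_nonneg _
  have hgu : H = cubeMean fun x => g x * u x := by
    rw [hu, cubeMean_mul_noiseOp]
    simp only [H, sq]
    rfl
  -- Two applications of Cauchy–Schwarz to `⟨g, u⟩` leave a fourth moment of `u`, which
  -- hypercontractivity bounds by `H ^ 2`.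
  have h1 : H ^ 2 ≤ cubeMean g * cubeMean (fun x => g x * u x ^ 2) := by
    have h := cubeMean_mul_sq_le (fun x => √(g x)) (fun x => √(g x) * u x)
    have e1 : ∀ x, √(g x) * (√(g x) * u x) = g x * u x := fun x => by
      rw [← mul_assoc, Real.mul_self_sqrt (hg x)]
    have e2 : ∀ x, √(g x) ^ 2 = g x := fun x => Real.sq_sqrt (hg x)
    simp only [e1, mul_pow, e2] at h
    rwa [hgu]
  have h2 := cubeMean_mul_sq_le g (fun x => u x ^ 2)
  simp only [← pow_mul] at h2
  have h3 : cubeMean (fun x => u x ^ (2 * 2)) ≤ H ^ 2 :=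
    noiseOp_hypercontractive (k := 2) (by norm_num) (by push_cast; linarith) h
  set m1 := cubeMean g
  set m2 := cubeMean (fun x => g x ^ 2)
  set w := cubeMean (fun x => g x * u x ^ 2)
  have hm2 : 0 ≤ m2 := cubeMean_nonneg fun _ => sq_nonneg _
  rcases hH0.eq_or_lt with h0 | hpos
  · rw [← h0, zero_pow two_ne_zero]
    positivity
  have h4 : H ^ 2 * H ^ 2 ≤ H ^ 2 * (m1 ^ 2 * m2) := by
    calc H ^ 2 * H ^ 2 = (H ^ 2) ^ 2 := by ring
      _ ≤ (m1 * w) ^ 2 := by gcongr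
      _ = m1 ^ 2 * w ^ 2 := by ring
      _ ≤ m1 ^ 2 * (m2 * H ^ 2) := by gcongr; exact h2.trans (by gcongr)
      _ = _ := by ring
  exact le_of_mul_le_mul_left h4 (by positivity)

/-- Iterating the previous inequality `k` times transfers decay at the strong noise `ρ ^ 2 ^ k` back
to the weak noise `ρ`. -/
theorem noiseOp_energy_ratio_pow_le (g : Cube n → ℝ) (hg : 0 < cubeMean fun x => g x ^ 2) (k : ℕ) :
    ∀ ρ : ℝ, ((cubeMean fun x => noiseOp ρ g x ^ 2) / cubeMean fun x => g x ^ 2) ^ 2 ^ k ≤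
      (cubeMean fun x => noiseOp (ρ ^ 2 ^ k) g x ^ 2) / cubeMean fun x => g x ^ 2 := by
  induction k with
  | zero => intro ρ; simp
  | succ k ih =>
    intro ρ
    rw [pow_succ', pow_mul, pow_mul]
    refine le_trans ?_ (ih (ρ ^ 2))
    refine pow_le_pow_left₀ (by positivity) ?_ _
    rw [div_pow, div_le_div_iff₀ (by positivity) hg]
    nlinarith [cubeMean_noiseOp_sq_sq_le ρ g]

end Decay

/-! ### Comparison of norms. -/

section Norms

variable {X : Type*} [NormedAddCommGroup X] {n : ℕ}

theorem cubeLpNorm_one (f : Cube n → X) : cubeLpNorm 1 f = cubeMean fun x => ‖f x‖ := by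
  simp [cubeLpNorm]

theorem cubeLpNorm_nonneg (p : ℝ) (f : Cube n → X) : 0 ≤ cubeLpNorm p f :=
  Real.rpow_nonneg (cubeMean_nonneg fun _ => Real.rpow_nonneg (norm_nonneg _) _) _

theorem cubeGradNorm_nonneg [NormedSpace ℝ X] (p : ℝ) (f : Cube n → X) : 0 ≤ cubeGradNorm p f :=
  Real.rpow_nonneg (cubeMean_nonneg fun _ => cubeMean_nonneg fun _ =>
    Real.rpow_nonneg (norm_nonneg _) _) _

theorem cubeLpNorm_two_sq (f : Cube n → X) :
    cubeLpNorm 2 f ^ 2 = cubeMean fun x => ‖f x‖ ^ 2 := by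
  have h : 0 ≤ cubeMean fun x => ‖f x‖ ^ 2 := cubeMean_nonneg fun _ => sq_nonneg _
  simp only [cubeLpNorm, Real.rpow_two]
  rw [← Real.sqrt_eq_rpow, Real.sq_sqrt h]

theorem cubeLpNorm_one_le_two (f : Cube n → X) : cubeLpNorm 1 f ≤ cubeLpNorm 2 f := by
  refine (sq_le_sq₀ (cubeLpNorm_nonneg _ _) (cubeLpNorm_nonneg _ _)).mp ?_
  rw [cubeLpNorm_two_sq, cubeLpNorm_one]
  have := cubeMean_mul_sq_le (fun x => ‖f x‖) fun _ => 1
  simpa [cubeMean_const] using this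

theorem cubeLpNorm_two_sq_le_one {f : Cube n → X} (hf : ∀ x, ‖f x‖ ≤ 1) :
    cubeLpNorm 2 f ^ 2 ≤ cubeLpNorm 1 f := by
  rw [cubeLpNorm_two_sq, cubeLpNorm_one]
  refine cubeMean_mono fun x => ?_
  nlinarith [hf x, norm_nonneg (f x)]

/-- Comparison of `Lᵖ` with `L²` for functions bounded by `b`. -/
theorem le_cubeLpNorm_of_le_cubeMean_sq {p b s : ℝ} (hb : 1 ≤ b) (hp1 : 1 ≤ p) (hp2 : p ≤ 2)
    (hs : 0 ≤ s) {d : Cube n → X} (hd : ∀ x, ‖d x‖ ≤ b)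
    (h : s ^ 2 ≤ cubeMean fun x => ‖d x‖ ^ 2) : s ^ (2 / p) / b ≤ cubeLpNorm p d := by
  have hp0 : 0 < p := by linarith
  have hb0 : 0 < b := by linarith
  have hpt : ∀ x, ‖d x‖ ^ 2 ≤ b * ‖d x‖ ^ p := by
    intro x
    rcases (norm_nonneg (d x)).eq_or_lt with h0 | h0
    · rw [← h0, Real.zero_rpow hp0.ne']
      simp
    · calc ‖d x‖ ^ 2 = ‖d x‖ ^ (2 - p) * ‖d x‖ ^ p := by
            rw [← Real.rpow_add h0, sub_add_cancel, Real.rpow_two]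
        _ ≤ b * ‖d x‖ ^ p := by
            gcongr
            calc ‖d x‖ ^ (2 - p) ≤ b ^ (2 - p) :=
                  Real.rpow_le_rpow h0.le (hd x) (by linarith)
              _ ≤ b ^ (1 : ℝ) := Real.rpow_le_rpow_of_exponent_le hb (by linarith)
              _ = b := Real.rpow_one b
  have h2 : s ^ 2 / b ≤ cubeMean fun x => ‖d x‖ ^ p := by
    rw [div_le_iff₀' hb0, ← cubeMean_const_mul]
    exact h.trans (cubeMean_mono hpt)
  have hp' : 0 ≤ 1 / p := by positivity
  calc s ^ (2 / p) / b ≤ s ^ (2 / p) / b ^ (1 / p) := by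
        gcongr
        calc b ^ (1 / p) ≤ b ^ (1 : ℝ) :=
              Real.rpow_le_rpow_of_exponent_le hb (by rw [div_le_iff₀ hp0]; linarith)
          _ = b := Real.rpow_one b
    _ = (s ^ 2 / b) ^ (1 / p) := by
        rw [Real.div_rpow (by positivity) hb0.le, ← Real.rpow_two, ← Real.rpow_mul hs]
        congr 2
        ring
    _ ≤ _ := Real.rpow_le_rpow (by positivity) h2 hp'

theorem sq_sub_le_cubeMean_norm_sub_sq (f g : Cube n → X) :
    (cubeLpNorm 2 f - cubeLpNorm 2 g) ^ 2 ≤ cubeMean fun x => ‖f x - g x‖ ^ 2 := by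
  have hcs := cubeMean_mul_sq_le (fun x => ‖f x‖) (fun x => ‖g x‖)
  rw [← cubeLpNorm_two_sq, ← cubeLpNorm_two_sq, ← mul_pow] at hcs
  have hcs' := le_of_sq_le_sq hcs
    (mul_nonneg (cubeLpNorm_nonneg 2 f) (cubeLpNorm_nonneg 2 g))
  have h : cubeMean (fun x => ‖f x‖ ^ 2 + ‖g x‖ ^ 2) ≤
      cubeMean fun x => ‖f x - g x‖ ^ 2 + 2 * (‖f x‖ * ‖g x‖) := by
    refine cubeMean_mono fun x => ?_
    have := sq_le_sq' (by linarith [norm_sub_norm_le (g x) (f x), norm_sub_rev (f x) (g x)])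
      (norm_sub_norm_le (f x) (g x))
    nlinarith
  rw [cubeMean_add, cubeMean_add, cubeMean_const_mul, ← cubeLpNorm_two_sq,
    ← cubeLpNorm_two_sq] at h
  linarith

end Norms

/-! ### The logarithmic gradient bound. -/

section Main

variable {X : Type*} [NormedAddCommGroup X] [NormedSpace ℝ X] {n : ℕ}

/-- A small amount of noise, of the order of the inverse of `log (e ‖f‖₂ / ‖f‖₁)`, already
decreases the `L²` norm by a constant factor. -/
theorem exists_noise_norm_le {κ : ℝ} (hκ : 1 < κ) (f : Cube n → X) (h1 : 0 < cubeLpNorm 1 f)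
    (hf : κ * cubeLpNorm 1 f ≤ cubeLpNorm 2 f) :
    ∃ ρ : ℝ, 0 ≤ ρ ∧ ρ ≤ 1 ∧
      1 - ρ ≤ 2 / Real.log (Real.exp 1 * cubeLpNorm 2 f / cubeLpNorm 1 f) ∧
      cubeLpNorm 2 (noiseOp ρ f) ≤
        Real.exp (-(Real.log κ / (1 + Real.log κ)) / 2) * cubeLpNorm 2 f := by
  set a := cubeLpNorm 2 f with ha
  set m := cubeLpNorm 1 f with hm
  have ha0 : 0 < a := lt_of_lt_of_le (by positivity) hf
  have hlk : 0 < Real.log κ := Real.log_pos hκ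
  set δ := Real.log κ / (1 + Real.log κ) with hδ
  set L := Real.log (Real.exp 1 * a / m) with hL
  have hL' : L = 1 + Real.log (a / m) := by
    rw [hL, mul_div_assoc, Real.log_mul (Real.exp_pos 1).ne' (by positivity), Real.log_exp]
  have hR : Real.log κ ≤ Real.log (a / m) :=
    Real.log_le_log (by linarith) (by rwa [le_div_iff₀ h1])
  have hL1 : 1 ≤ L := by linarith
  -- `s / (1 + s)` increases in `s`, and `log (a / m) ≥ log κ`.
  have hδL : δ * L ≤ Real.log (a / m) := by
    rw [hδ, div_mul_eq_mul_div, div_le_iff₀ (by linarith), hL']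
    nlinarith
  obtain ⟨k, hk1, hk2⟩ := exists_nat_pow_near hL1 (one_lt_two : (1 : ℝ) < 2)
  have hl3 : Real.log 3 ≤ 2 := by
    have := Real.log_le_sub_one_of_pos (show (0 : ℝ) < 3 by norm_num)
    linarith
  have hl30 : 0 < Real.log 3 := Real.log_pos (by norm_num)
  -- Chosen so that `2 ^ k` squarings and multiplications amount to `exp (-t) ^ 2 ^ k = 1 / √3`, the
  -- threshold for hypercontractivity into `L⁴`.
  set t := Real.log 3 / 2 / 2 ^ k with ht
  have ht0 : 0 ≤ t := by positivity
  have hρ0 : 0 ≤ Real.exp (-t) := (Real.exp_pos _).le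
  have hρ1 : Real.exp (-t) ≤ 1 := Real.exp_le_one_iff.mpr (by linarith)
  refine ⟨Real.exp (-t), hρ0, hρ1, ?_, ?_⟩
  · have e1 : 1 - Real.exp (-t) ≤ t := by linarith [Real.add_one_le_exp (-t)]
    refine e1.trans ?_
    rw [ht, div_le_div_iff₀ (by positivity) (by linarith)]
    rw [pow_succ] at hk2
    nlinarith
  · set g : Cube n → ℝ := fun x => ‖f x‖ with hg
    have hD : cubeMean (fun x => g x ^ 2) = a ^ 2 := (cubeLpNorm_two_sq f).symm
    have hmg : cubeMean g = m := (cubeLpNorm_one f).symm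
    set H := cubeMean fun x => noiseOp (Real.exp (-t)) g x ^ 2 with hH
    have hH0 : 0 ≤ H := cubeMean_nonneg fun _ => sq_nonneg _
    have hpow : Real.exp (-t) ^ 2 ^ k = Real.exp (-(Real.log 3 / 2)) := by
      rw [← Real.exp_nat_mul]
      congr 1
      rw [ht]
      push_cast
      field_simp
    have hsq : Real.exp (-(Real.log 3 / 2)) ^ 2 * 3 ≤ 1 := by
      rw [← Real.exp_nat_mul]
      have : ((2 : ℕ) : ℝ) * -(Real.log 3 / 2) = -Real.log 3 := by push_cast; ring
      rw [this, Real.exp_neg, Real.exp_log (by norm_num)]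
      norm_num
    have hend : cubeMean (fun x => noiseOp (Real.exp (-(Real.log 3 / 2))) g x ^ 2) ≤ m * a := by
      have h := cubeMean_noiseOp_sq_sq_le_mean hsq (g := g) fun x => norm_nonneg _
      rw [hD, hmg, ← mul_pow] at h
      exact le_of_sq_le_sq h (by positivity)
    have hrat := noiseOp_energy_ratio_pow_le g (by rw [hD]; positivity) k (Real.exp (-t))
    rw [hpow, hD, ← hH] at hrat
    -- The energy ratio at `1 / √3` is at most `m / a ≤ exp (-δL)`, and `2 ^ k ≤ L` permits
    -- extracting a `2 ^ k`-th root.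
    have hrat2 : (H / a ^ 2) ^ 2 ^ k ≤ Real.exp (-δ) ^ 2 ^ k := by
      calc (H / a ^ 2) ^ 2 ^ k ≤ m * a / a ^ 2 := hrat.trans (by gcongr)
        _ = Real.exp (-Real.log (a / m)) := by
          rw [Real.exp_neg, Real.exp_log (by positivity)]
          field_simp
        _ ≤ Real.exp (-(δ * L)) := Real.exp_le_exp.mpr (by linarith)
        _ ≤ Real.exp (((2 ^ k : ℕ) : ℝ) * -δ) := by
          refine Real.exp_le_exp.mpr ?_
          have hδ0 : 0 < δ := by positivity
          push_cast
          nlinarith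
        _ = _ := Real.exp_nat_mul _ _
    have hHD : H ≤ Real.exp (-δ) * a ^ 2 := by
      have := (pow_le_pow_iff_left₀ (by positivity) (Real.exp_pos _).le (by positivity)).mp hrat2
      rwa [div_le_iff₀ (by positivity)] at this
    refine le_of_sq_le_sq ?_ (by positivity)
    rw [cubeLpNorm_two_sq, mul_pow, ← Real.exp_nat_mul]
    have e2 : ((2 : ℕ) : ℝ) * (-δ / 2) = -δ := by push_cast; ring
    rw [e2]
    refine le_trans (cubeMean_mono fun x => ?_) hHD
    exact pow_le_pow_left₀ (norm_nonneg _) (norm_noiseOp_le hρ0 hρ1 f x) 2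

theorem noiseOp_norm_le_one {ρ : ℝ} (h0 : 0 ≤ ρ) (h1 : ρ ≤ 1) {f : Cube n → X}
    (hf : ∀ x, ‖f x‖ ≤ 1) (x : Cube n) : ‖noiseOp ρ f x‖ ≤ 1 :=
  (norm_noiseOp_le h0 h1 f x).trans
    ((noiseOp_mono h0 h1 hf x).trans_eq (noiseOp_const ρ 1 x))

/-- The logarithmically improved lower bound for the gradient of a function whose `L²` norm exceeds
its `L¹` norm by a factor `κ > 1`. -/
theorem log_mul_le_cubeGradNorm {p q C κ : ℝ} (hκ : 1 < κ) (hC : IsCotypeBound X q C)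
    (hq : 2 ≤ q) (hp1 : 1 ≤ p) (hp2 : p ≤ 2) {f : Cube n → X} (hf : ∀ x, ‖f x‖ ≤ 1)
    (h1 : 0 < cubeLpNorm 1 f) (hκf : κ * cubeLpNorm 1 f ≤ cubeLpNorm 2 f) :
    (1 - Real.exp (-(Real.log κ / (1 + Real.log κ)) / 2)) ^ 2 *
        (cubeLpNorm 2 f ^ (2 / p) *
          Real.log (Real.exp 1 * cubeLpNorm 2 f / cubeLpNorm 1 f) ^ (1 / q)) ≤
      24 * √2 * (q ^ (3 / 2 : ℝ) * C) * cubeGradNorm p f := by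
  obtain ⟨ρ, hρ0, hρ1, hρL, hρn⟩ := exists_noise_norm_le hκ f h1 hκf
  have hq0 : 0 < q := by linarith
  have hp0 : 0 < p := by linarith
  have hC0 := hC.1
  have hG0 := cubeGradNorm_nonneg p f
  have hlk : 0 < Real.log κ := Real.log_pos hκ
  set a := cubeLpNorm 2 f
  set m := cubeLpNorm 1 f
  set θ := Real.exp (-(Real.log κ / (1 + Real.log κ)) / 2) with hθ
  set L := Real.log (Real.exp 1 * a / m) with hL
  set G := cubeGradNorm p f
  have ha0 : 0 < a := lt_of_lt_of_le (by positivity) hκf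
  have hL0 : 0 < L := by
    refine Real.log_pos ?_
    rw [lt_div_iff₀ h1, one_mul]
    have : 1 < Real.exp 1 := Real.one_lt_exp_iff.mpr one_pos
    nlinarith
  have hθ0 : 0 < θ := Real.exp_pos _
  have hθ1 : θ < 1 := by
    rw [hθ, Real.exp_lt_one_iff, neg_div]
    have : 0 < Real.log κ / (1 + Real.log κ) / 2 := by positivity
    linarith
  have hη0 : 0 < 1 - θ := by linarith
  have hsq : ((1 - θ) * a) ^ 2 ≤ cubeMean fun x => ‖f x - noiseOp ρ f x‖ ^ 2 := by
    refine le_trans ?_ (sq_sub_le_cubeMean_norm_sub_sq f (noiseOp ρ f))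
    refine pow_le_pow_left₀ (by positivity) ?_ 2
    change (1 - θ) * a ≤ a - cubeLpNorm 2 (noiseOp ρ f)
    linarith
  -- Both `f` and its noised version are bounded by `1`, so the difference is bounded by `2`.
  have hlow := le_cubeLpNorm_of_le_cubeMean_sq one_le_two hp1 hp2 (by positivity)
    (fun x => (norm_sub_le _ _).trans
      (by linarith [hf x, noiseOp_norm_le_one hρ0 hρ1 hf x])) hsq
  have hup := cubeLpNorm_sub_noiseOp_le hC hq hp1 (by linarith) hρ0 hρ1 f
  have hη : (1 - θ) ^ 2 ≤ (1 - θ) ^ (2 / p) := by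
    rw [← Real.rpow_two]
    refine Real.rpow_le_rpow_of_exponent_ge hη0 (by linarith) ?_
    rw [div_le_iff₀ hp0]
    linarith
  have hτ : (1 - ρ) ^ (1 / q) * L ^ (1 / q) ≤ 2 := by
    rw [← Real.mul_rpow (by linarith) hL0.le]
    have h2 : (1 - ρ) * L ≤ 2 := (le_div_iff₀ hL0).mp hρL
    calc ((1 - ρ) * L) ^ (1 / q) ≤ 2 ^ (1 / q) :=
          Real.rpow_le_rpow (mul_nonneg (by linarith) hL0.le) h2 (by positivity)
      _ ≤ 2 ^ (1 : ℝ) := Real.rpow_le_rpow_of_exponent_le (by norm_num)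
          (by rw [div_le_iff₀ hq0]; linarith)
      _ = 2 := Real.rpow_one 2
  have hq32 : √q * q = q ^ (3 / 2 : ℝ) := by
    rw [Real.sqrt_eq_rpow]
    nth_rw 2 [← Real.rpow_one q]
    rw [← Real.rpow_add hq0]
    norm_num
  have hLq : 0 ≤ L ^ (1 / q) := by positivity
  calc (1 - θ) ^ 2 * (a ^ (2 / p) * L ^ (1 / q))
      ≤ (1 - θ) ^ (2 / p) * (a ^ (2 / p) * L ^ (1 / q)) := by gcongr
    _ = 2 * (((1 - θ) * a) ^ (2 / p) / 2) * L ^ (1 / q) := by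
        rw [Real.mul_rpow hη0.le ha0.le]
        ring
    _ ≤ 2 * (6 * √2 * √q * C * q * (1 - ρ) ^ (1 / q) * G) * L ^ (1 / q) := by
        gcongr
        exact hlow.trans hup
    _ = 12 * √2 * (q ^ (3 / 2 : ℝ) * C) * G * ((1 - ρ) ^ (1 / q) * L ^ (1 / q)) := by
        rw [← hq32]
        ring
    _ ≤ 12 * √2 * (q ^ (3 / 2 : ℝ) * C) * G * 2 := by gcongr
    _ = _ := by ring

/-- A Poincaré inequality for mean zero functions bounded by one. -/
theorem rpow_le_cubeGradNorm_of_mean_zero {p q C : ℝ} (hC : IsCotypeBound X q C)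
    (hq : 2 ≤ q) (hp1 : 1 ≤ p) (hp2 : p ≤ 2) {f : Cube n → X} (hf : ∀ x, ‖f x‖ ≤ 1)
    (h0 : cubeMean f = 0) :
    cubeLpNorm 2 f ^ (2 / p) ≤ 6 * √2 * (q ^ (3 / 2 : ℝ) * C) * cubeGradNorm p f := by
  have hq0 : 0 < q := by linarith
  have hlow := le_cubeLpNorm_of_le_cubeMean_sq le_rfl hp1 hp2 (cubeLpNorm_nonneg 2 f) hf
    (cubeLpNorm_two_sq f).le
  have hup := cubeLpNorm_sub_noiseOp_le hC hq hp1 (by linarith) le_rfl zero_le_one f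
  simp only [noiseOp_zero, h0, sub_zero, Real.one_rpow, mul_one] at hup
  have hq32 : √q * q = q ^ (3 / 2 : ℝ) := by
    rw [Real.sqrt_eq_rpow]
    nth_rw 2 [← Real.rpow_one q]
    rw [← Real.rpow_add hq0]
    norm_num
  rw [div_one] at hlow
  refine (hlow.trans hup).trans_eq ?_
  rw [← hq32]
  ring

/-- `K` will be `q ^ (3 / 2) * cotypeConst X q`, which may vanish for trivial `X`; then `0⁻¹ = 0`
makes the left side `0`. -/
theorem inv_mul_mul_le_of_mul_le {c M K Y G : ℝ} (hM : 0 < M) (hK : 0 ≤ K) (hG : 0 ≤ G)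
    (h : c * Y ≤ M * K * G) : c / M * K⁻¹ * Y ≤ G := by
  rcases hK.eq_or_lt with h0 | hK
  · simpa [← h0] using hG
  · have e : c / M * K⁻¹ * Y = c * Y / (M * K) := by
      field_simp
    rw [e, div_le_iff₀ (by positivity)]
    linarith

theorem log_rpow_mul_le_cubeGradNorm {p q κ : ℝ} (hκ : 1 < κ) (hX : HasCotype X q)
    (hq : 2 ≤ q) (hp1 : 1 ≤ p) (hp2 : p ≤ 2) {f : Cube n → X} (hf : ∀ x, ‖f x‖ ≤ 1)
    (hκf : κ * cubeLpNorm 1 f ≤ cubeLpNorm 2 f) :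
    (1 - Real.exp (-(Real.log κ / (1 + Real.log κ)) / 2)) ^ 2 / (24 * √2) *
        (q ^ (3 / 2 : ℝ) * cotypeConst X q)⁻¹ * cubeLpNorm 2 f ^ (2 / p) *
          Real.log (Real.exp 1 * cubeLpNorm 2 f / cubeLpNorm 1 f) ^ (1 / q) ≤
      cubeGradNorm p f := by
  have hC := isCotypeBound_cotypeConst (by linarith) hX
  have hC0 := hC.1
  rcases (cubeLpNorm_nonneg 1 f).eq_or_lt with h0 | h1
  · have h2 := cubeLpNorm_two_sq_le_one hf
    rw [← h0] at h2
    have h3 : cubeLpNorm 2 f = 0 := pow_eq_zero_iff two_ne_zero |>.mp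
      (le_antisymm h2 (sq_nonneg _))
    rw [h3, Real.zero_rpow (by positivity)]
    simpa using cubeGradNorm_nonneg p f
  · rw [mul_assoc _ (cubeLpNorm 2 f ^ (2 / p))]
    exact inv_mul_mul_le_of_mul_le (by positivity) (by positivity) (cubeGradNorm_nonneg p f)
      (log_mul_le_cubeGradNorm hκ hC hq hp1 hp2 hf h1 hκf)

/-- Here the logarithm is below `2`, so the Poincaré inequality suffices at the cost of doubling
`6√2`. -/
theorem mean_zero_log_rpow_mul_le_cubeGradNorm {p q : ℝ} (hX : HasCotype X q)
    (hq : 2 ≤ q) (hp1 : 1 ≤ p) (hp2 : p ≤ 2) {f : Cube n → X} (hf : ∀ x, ‖f x‖ ≤ 1)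
    (h0 : cubeMean f = 0) (hκf : cubeLpNorm 2 f < Real.exp 1 * cubeLpNorm 1 f) :
    1 / (12 * √2) * (q ^ (3 / 2 : ℝ) * cotypeConst X q)⁻¹ * cubeLpNorm 2 f ^ (2 / p) *
          Real.log (Real.exp 1 * cubeLpNorm 2 f / cubeLpNorm 1 f) ^ (1 / q) ≤
      cubeGradNorm p f := by
  have hq0 : 0 < q := by linarith
  have hC := isCotypeBound_cotypeConst hq0 hX
  have hC0 := hC.1
  have h12 := cubeLpNorm_one_le_two f
  have h1 : 0 < cubeLpNorm 1 f := by
    have := (cubeLpNorm_nonneg 2 f).trans_lt hκf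
    exact pos_of_mul_pos_right this (Real.exp_pos _).le
  have h2 : 0 < cubeLpNorm 2 f := h1.trans_le h12
  have hP := rpow_le_cubeGradNorm_of_mean_zero hC hq hp1 hp2 hf h0
  rw [mul_assoc _ (cubeLpNorm 2 f ^ (2 / p))]
  refine inv_mul_mul_le_of_mul_le (by positivity) (by positivity) (cubeGradNorm_nonneg p f) ?_
  have hL0 : 0 ≤ Real.log (Real.exp 1 * cubeLpNorm 2 f / cubeLpNorm 1 f) := by
    refine Real.log_nonneg ?_
    rw [le_div_iff₀ h1, one_mul]
    have : 1 < Real.exp 1 := Real.one_lt_exp_iff.mpr one_pos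
    nlinarith
  have hL2 : Real.log (Real.exp 1 * cubeLpNorm 2 f / cubeLpNorm 1 f) ≤ 2 := by
    have he2 : Real.exp 2 = Real.exp 1 * Real.exp 1 := by
      rw [← Real.exp_add]
      norm_num
    rw [Real.log_le_iff_le_exp (by positivity), div_le_iff₀ h1, he2, mul_assoc]
    gcongr
  have hLq : Real.log (Real.exp 1 * cubeLpNorm 2 f / cubeLpNorm 1 f) ^ (1 / q) ≤ 2 := by
    calc _ ≤ (2 : ℝ) ^ (1 / q) := Real.rpow_le_rpow hL0 hL2 (by positivity)
      _ ≤ 2 ^ (1 : ℝ) := Real.rpow_le_rpow_of_exponent_le (by norm_num)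
          (by rw [div_le_iff₀ hq0]; linarith)
      _ = 2 := Real.rpow_one 2
  calc _ ≤ 1 * (cubeLpNorm 2 f ^ (2 / p) * 2) := by gcongr
    _ ≤ _ := by linarith

end Main

theorem one_sub_exp_sq_div_pos {κ : ℝ} (hκ : 1 < κ) :
    0 < (1 - Real.exp (-(Real.log κ / (1 + Real.log κ)) / 2)) ^ 2 / (24 * √2) := by
  have hlk : 0 < Real.log κ := Real.log_pos hκ
  have h : Real.exp (-(Real.log κ / (1 + Real.log κ)) / 2) < 1 := by
    rw [Real.exp_lt_one_iff, neg_div]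
    have : 0 < Real.log κ / (1 + Real.log κ) / 2 := by positivity
    linarith
  have h' : 0 < 1 - Real.exp (-(Real.log κ / (1 + Real.log κ)) / 2) := by linarith
  positivity

theorem mainTheorem8 :
    (∃ c : ℝ, 0 < c ∧
      ∀ (X : Type*) [NormedAddCommGroup X] [NormedSpace ℝ X] [CompleteSpace X]
        (q : ℝ), 2 ≤ q → HasCotype X q →
      ∀ (n : ℕ) (f : Cube n → X), (∀ x, ‖f x‖ ≤ 1) → cubeMean f = 0 →
      ∀ p : ℝ, 1 ≤ p → p ≤ 2 →
        c * (q ^ (3 / 2 : ℝ) * cotypeConst X q)⁻¹ * cubeLpNorm 2 f ^ (2 / p) *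
            Real.log (Real.exp 1 * cubeLpNorm 2 f / cubeLpNorm 1 f) ^ (1 / q)
          ≤ cubeGradNorm p f) ∧
    (∀ κ : ℝ, 1 < κ → ∃ c : ℝ, 0 < c ∧
      ∀ (X : Type*) [NormedAddCommGroup X] [NormedSpace ℝ X] [CompleteSpace X]
        (q : ℝ), 2 ≤ q → HasCotype X q →
      ∀ (n : ℕ) (f : Cube n → X), (∀ x, ‖f x‖ ≤ 1) →
        κ * cubeLpNorm 1 f ≤ cubeLpNorm 2 f →
      ∀ p : ℝ, 1 ≤ p → p ≤ 2 →
        c * (q ^ (3 / 2 : ℝ) * cotypeConst X q)⁻¹ * cubeLpNorm 2 f ^ (2 / p) *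
            Real.log (Real.exp 1 * cubeLpNorm 2 f / cubeLpNorm 1 f) ^ (1 / q)
          ≤ cubeGradNorm p f) := by
  have he : 1 < Real.exp 1 := Real.one_lt_exp_iff.mpr one_pos
  -- For (a) the cases split at `κ = e`, and the smaller of the two constants serves both.
  refine ⟨⟨min ((1 - Real.exp (-(Real.log (Real.exp 1) / (1 + Real.log (Real.exp 1))) / 2)) ^ 2 /
      (24 * √2)) (1 / (12 * √2)), lt_min (one_sub_exp_sq_div_pos he) (by positivity), ?_⟩, ?_⟩
  · intro X _ _ _ q hq hX n f hf h0 p hp1 hp2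
    have hC0 := (isCotypeBound_cotypeConst (by linarith) hX).1
    have h2 := cubeLpNorm_nonneg 2 f
    have hL : 0 ≤ Real.log (Real.exp 1 * cubeLpNorm 2 f / cubeLpNorm 1 f) := by
      rcases (cubeLpNorm_nonneg 1 f).eq_or_lt with h | h
      · simp [← h]
      · refine Real.log_nonneg ?_
        rw [le_div_iff₀ h, one_mul]
        nlinarith [cubeLpNorm_one_le_two f]
    rcases le_or_gt (Real.exp 1 * cubeLpNorm 1 f) (cubeLpNorm 2 f) with h | h
    · refine le_trans ?_ (log_rpow_mul_le_cubeGradNorm he hX hq hp1 hp2 hf h)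
      gcongr
      exact min_le_left _ _
    · refine le_trans ?_ (mean_zero_log_rpow_mul_le_cubeGradNorm hX hq hp1 hp2 hf h0 h)
      gcongr
      exact min_le_right _ _
  · intro κ hκ
    exact ⟨_, one_sub_exp_sq_div_pos hκ, fun X _ _ _ q hq hX n f hf h p hp1 hp2 =>
      log_rpow_mul_le_cubeGradNorm hκ hX hq hp1 hp2 hf h⟩
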